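/- Consider the following dynamic matching market. Agents of type $H$ and of type $E$ arrive according to independent Poisson processes with rates $\lambda_H>0$ and $\lambda_E>0$. An agent of type $H$ (resp. $E$) finds the item of any other agent compatible with probability $p_H$ (resp. $p_E$), independently. An agent leaves the market when she receives a compatible item. - Under BilateralMatch(H), each arriving agent forms a 2-cycle (mutual compatibility) with a waiting agent if possible, cycles with $H$ agents having priority and further ties being broken uniformly at random; both agents then leave. Otherwise the arriving agent waits. - Under ChainMatch(d) there are always $d$ bridge agents who can give an item. If an arriving agent finds the item of at least one bridge agent compatible, she is matched by one of them and starts a chain-segment: the last agent of the segment gives her item to a waiting agent not yet in the segment who finds it compatible ($H$ agents first, ties broken uniformly at random), who becomes the last agent of the segment, and so on until no such agent exists. This is instantaneous; all agents of the segment leave the market, and the last one becomes a bridge agent in place of the one who started the segment. Otherwise the arriving agent waits. Under either policy the number of waiting agents of each type is a continuous-time Markov chain on $\mathbb{N}^2$. Let $w_H$ be the average waiting time of $H$ agents in steady-state, i.e. the expected waiting time of an $H$ agent who arrives when this chain is in its stationary distribution; write $w_H^{\mathcal{C}(d)}$ and $w_H^{\mathcal{B}_H}$ for its values under ChainMatch(d)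 and BilateralMatch(H). Let $0<\lambda_H<\lambda_E$, $p_E\in(0,1]$ and let $d\ge 1$ be an integer, all fixed. Then for every $p_H\in(0,1]$ the Markov chain of each of the two policies has exactly one stationary distribution, both of the limits below exist and are finite, and $$0<\lim_{p_H\to 0^+} p_H\, w_H^{\mathcal{C}(d)} < \lim_{p_H\to 0^+} p_H\, w_H^{\mathcal{B}_H}.$$ In particular, both average waiting times scale as $1/p_H$, and chains beat bilateral matching asymptotically by a constant factor. -/

import Mathlib

namespace DynMatch

/-- The two types of agents: hard-to-match (`H`) and easy-to-match (`E`). -/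
inductive Kind
  | H
  | E

/-- The state of the market: `(h, e)` is the number of waiting `H` agents and of waiting `E`
agents. -/
abbrev Market := ℕ × ℕ

/-- The point mass at the state `s`. -/
noncomputable def pt (s t : Market) : ℝ := if t = s then 1 else 0

/-- `find p n` is the probability that at least one of `n` independent trials with success
probability `p` succeeds. -/
noncomputable def find (p : ℝ) (n : ℕ) : ℝ := 1 - (1 - p) ^ n

/-- The probability that an agent of the given type finds a given item compatible. -/
def acceptProb (pH pE : ℝ) : Kind → ℝ
  | Kind.H => pH
  | Kind.E => pE

/-- The state after a newly arrived agent of the given type has joined the market. -/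
def join : Kind → Market → Market
  | Kind.H, s => (s.1 + 1, s.2)
  | Kind.E, s => (s.1, s.2 + 1)

/-- BilateralMatch(H): `bilateralMatchH pH pE k s t` is the probability that the arrival of an
agent of type `k` at state `s` leads to state `t`. A cycle with a given waiting agent of type `T`
exists with probability `p_k * p_T`. Cycles with `H` agents come first, then cycles with `E` agents;
without a cycle the new agent joins the market.
(For `s.1 = 0` or `s.2 = 0` the truncated subtraction comes with the factor `find _ 0 = 0`.) -/
noncomputable def bilateralMatchH (pH pE : ℝ) (k : Kind) (s t : Market) : ℝ :=
  let a := acceptProb pH pE k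
  find (a * pH) s.1 * pt (s.1 - 1, s.2) t
    + (1 - find (a * pH) s.1) * find (a * pE) s.2 * pt (s.1, s.2 - 1) t
    + (1 - find (a * pH) s.1) * (1 - find (a * pE) s.2) * pt (join k s) t

/-- Local search for a chain-segment: `segmentEnd pH pE h e t` is the probability that the market is
left in state `t`, when `h` and `e` agents are waiting outside the segment and the present last
agent of the segment has to give her item. If some waiting `H` agent finds the item compatible, one
such agent is appended; otherwise, if some waiting `E` agent finds it compatible, one such agent is
appended; otherwise the segment ends. The edges out of the present last agent have not been
examined before. -/
noncomputable def segmentEnd (pH pE : ℝ) : ℕ → ℕ → Market → ℝ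
  | 0, 0, t => pt (0, 0) t
  | 0, e + 1, t =>
      find pE (e + 1) * segmentEnd pH pE 0 e t
        + (1 - find pE (e + 1)) * pt (0, e + 1) t
  | h + 1, 0, t =>
      find pH (h + 1) * segmentEnd pH pE h 0 t
        + (1 - find pH (h + 1)) * pt (h + 1, 0) t
  | h + 1, e + 1, t =>
      find pH (h + 1) * segmentEnd pH pE h (e + 1) t
        + (1 - find pH (h + 1)) * find pE (e + 1) * segmentEnd pH pE (h + 1) e t
        + (1 - find pH (h + 1)) * (1 - find pE (e + 1)) * pt (h + 1, e + 1) t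
termination_by h e => h + e

/-- ChainMatch(d): `chainMatch d pH pE k s t` is the probability that the arrival of an agent of
type `k` at state `s` leads to state `t`. If she finds the item of one of the `d` bridge agents
compatible, she is matched and starts a chain-segment; otherwise she joins the market. -/
noncomputable def chainMatch (d : ℕ) (pH pE : ℝ) (k : Kind) (s t : Market) : ℝ :=
  find (acceptProb pH pE k) d * segmentEnd pH pE s.1 s.2 t
    + (1 - find (acceptProb pH pE k) d) * pt (join k s) t

/-- The transition rate matrix (diagonal included) of the continuous-time Markov chain of the
market: agents of type `H` and `E` arrive by independent Poisson processes of rates `lamH`, `lamE`,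
and an arrival of type `k` moves the market according to `P k`. -/
noncomputable def rateMatrix (lamH lamE : ℝ) (P : Kind → Market → Market → ℝ) (s t : Market) : ℝ :=
  lamH * (P Kind.H s t - pt s t) + lamE * (P Kind.E s t - pt s t)

/-- `π` is a steady-state distribution for the rate matrix `Q`: a probability distribution with
`π Q = 0`. -/
structure IsSteadyState (Q : Market → Market → ℝ) (π : Market → ℝ) : Prop where
  nonneg : ∀ s, 0 ≤ π s
  total : HasSum π 1
  balance : ∀ t, HasSum (fun s => π s * Q s t) 0

/-- The steady-state distribution for `Q` (meaningful when there is exactly one). -/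
noncomputable def steadyState (Q : Market → Market → ℝ) : Market → ℝ :=
  Classical.epsilon (IsSteadyState Q)

/-- `stay lamH lamE P n s` is the probability that a given `H` agent, waiting at state `s` (she is
one of the `s.1 ≥ 1` waiting `H` agents), is still waiting after the next `n` arrivals. An arrival
is of type `H` with probability `lamH / (lamH + lamE)`. An arrival that moves the market from `s`
to `t` either joins or removes `s.1 - t.1` of the `s.1` waiting `H` agents; ties within a type
being broken uniformly at random, a given one of them remains with probability
`min s.1 t.1 / s.1`. -/
noncomputable def stay (lamH lamE : ℝ) (P : Kind → Market → Market → ℝ) : ℕ → Market → ℝ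
  | 0, _ => 1
  | n + 1, s => ∑' t : Market,
      (lamH * P Kind.H s t + lamE * P Kind.E s t) / (lamH + lamE)
        * ((min s.1 t.1 : ℕ) / (s.1 : ℝ)) * stay lamH lamE P n t

/-- The expected remaining waiting time of a given `H` agent waiting at state `s`: she leaves at
an arrival epoch, and the times between consecutive arrivals have mean `1 / (lamH + lamE)` and are
independent of the types of the arrivals and of the transitions. -/
noncomputable def remainingWait (lamH lamE : ℝ) (P : Kind → Market → Market → ℝ) (s : Market) :
    ENNReal :=
  ∑' n : ℕ, ENNReal.ofReal (stay lamH lamE P n s / (lamH + lamE))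

/-- The average waiting time `w_H` in steady-state: the expected waiting time of an `H` agent who
arrives when the market is in steady-state. If she is matched at once, she does not wait; she joins
the market exactly when the number of waiting `H` agents goes up by one. -/
noncomputable def avgWaitH (lamH lamE : ℝ) (P : Kind → Market → Market → ℝ) : ENNReal :=
  ∑' s : Market, ENNReal.ofReal (steadyState (rateMatrix lamH lamE P) s) *
    ∑' t : Market,
      if t.1 = s.1 + 1 then ENNReal.ofReal (P Kind.H s t) * remainingWait lamH lamE P t else 0

end DynMatch

/-! The number h of waiting `H` agents grows like 1/pH, so one follows the rescaled count x = θh,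
where θ = -log(1 - q) and q is the probability that a given `H` agent can be matched at a given
attempt. Then all of h such agents fail with probability exactly exp(-x).

Under BilateralMatch(H) one has q = pE * pH. An arriving `E` agent removes an `H` agent with
probability 1 - exp(-x), and an arriving `H` agent nearly always joins, so the balance is lamH =
lamE (1 - exp(-x)), that is x = -log(1 - u) with u = lamH / lamE. Under ChainMatch(d) one has q =
pH. Every `E` agent, on arrival or later, enters a segment and there gives rise to a run of `H`
agents with mean length about exp(x) - 1; the balance is lamH = lamE (exp(x) - 1), so x = log(1 +
u). Dividing by θ, which is asymptotic to pE * pH or to pH, and applying Little's law gives the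
limits -log(1 - u) / (pE * lamH) and log(1 + u) / lamH. They are ordered since (1 + u)(1 - u) < 1
and pE ≤ 1.

Concentration of x at the balance point is proved by Foster-Lyapunov estimates for the jump chain:
`FinKernel.IsStat.drift_bound` turns a drift inequality into a bound on a stationary mean. Quadratic
functions suffice in the bilateral case (`bilateral_mean_bound`). For chains, the Lyapunov function
is made from the recursion for a segment, so that its mean change can be computed although segments
are unbounded (`segment_mean_compensated`, `chain_mean_bound`); a separate estimate controls the
tail (`chain_tail_bound`). In both cases the mean deviation of x is at most ε plus a term of order
θ. Little's law is `IsPolicy.avgWaitH_eq`; existence and uniqueness of the steady state come from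
`FinKernel.exists_isStat` and `FinKernel.IsStat.unique`. -/

open Filter Topology
open scoped ENNReal

namespace DynMatch

/-! ### Stationary distributions of discrete Markov kernels -/

/-- A Markov kernel on a discrete space whose rows are finitely supported. -/
structure FinKernel (S : Type*) where
  /-- transition probabilities -/
  P : S → S → ℝ
  /-- a finite set that carries the row of a state -/
  N : S → Finset S
  nonneg : ∀ s t, 0 ≤ P s t
  supp : ∀ s t, t ∉ N s → P s t = 0
  sum_one : ∀ s, ∑ t ∈ N s, P s t = 1

namespace FinKernel

variable {S : Type*} (κ : FinKernel S)

/-- The action of a kernel on functions. -/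
noncomputable def op : (S → ℝ) →ₗ[ℝ] (S → ℝ) where
  toFun f s := ∑ t ∈ κ.N s, κ.P s t * f t
  map_add' f g := by
    funext s; simp [mul_add, Finset.sum_add_distrib]
  map_smul' c f := by
    funext s; simp only [Pi.smul_apply, smul_eq_mul, RingHom.id_apply, Finset.mul_sum]
    exact Finset.sum_congr rfl fun _ _ => by ring

theorem op_apply (f : S → ℝ) (s : S) : κ.op f s = ∑ t ∈ κ.N s, κ.P s t * f t := rfl

theorem op_mono {f g : S → ℝ} (h : ∀ s, f s ≤ g s) (s : S) : κ.op f s ≤ κ.op g s :=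
  Finset.sum_le_sum fun t _ => mul_le_mul_of_nonneg_left (h t) (κ.nonneg s t)

theorem op_const (c : ℝ) : κ.op (fun _ => c) = fun _ => c := by
  funext s; rw [op_apply, ← Finset.sum_mul, κ.sum_one, one_mul]

theorem hasSum_row (f : S → ℝ) (s : S) : HasSum (fun t => κ.P s t * f t) (κ.op f s) :=
  hasSum_sum_of_ne_finset_zero fun t ht => by rw [κ.supp s t ht, zero_mul]

theorem op_pow_mono (n : ℕ) {f g : S → ℝ} (h : ∀ s, f s ≤ g s) (s : S) :
    (κ.op ^ n) f s ≤ (κ.op ^ n) g s := by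
  induction n generalizing s with
  | zero => simpa using h s
  | succ n ih => rw [pow_succ']; exact κ.op_mono ih s

theorem op_pow_const (n : ℕ) (c : ℝ) : (κ.op ^ n) (fun _ => c) = fun _ => c := by
  induction n with
  | zero => simp
  | succ n ih => rw [pow_succ', Module.End.mul_apply, ih, op_const]

/-- Cesàro average along the chain started at `o`. -/
noncomputable def avg (o : S) (n : ℕ) : (S → ℝ) →ₗ[ℝ] ℝ :=
  ((n : ℝ) + 1)⁻¹ • ∑ k ∈ Finset.range (n + 1), (LinearMap.proj o).comp (κ.op ^ k)

theorem avg_apply (o : S) (n : ℕ) (f : S → ℝ) :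
    κ.avg o n f = ((n : ℝ) + 1)⁻¹ * ∑ k ∈ Finset.range (n + 1), (κ.op ^ k) f o := by
  simp [avg, LinearMap.sum_apply]

theorem avg_mono (o : S) (n : ℕ) {f g : S → ℝ} (h : ∀ s, f s ≤ g s) :
    κ.avg o n f ≤ κ.avg o n g := by
  rw [avg_apply, avg_apply]
  exact mul_le_mul_of_nonneg_left (Finset.sum_le_sum fun k _ => κ.op_pow_mono k h o) (by positivity)

theorem avg_const (o : S) (n : ℕ) (c : ℝ) : κ.avg o n (fun _ => c) = c := by
  rw [avg_apply, Finset.sum_congr rfl fun k _ => congrFun (κ.op_pow_const k c) o]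
  have : (n : ℝ) + 1 ≠ 0 := by positivity
  simp; field_simp

/-- The sum telescopes: one more step of the chain changes only the two end terms. The defect is
O(1/n), which makes limits of the averages invariant and lets drift inequalities be averaged. -/
theorem avg_op (o : S) (n : ℕ) (f : S → ℝ) :
    κ.avg o n (κ.op f) = κ.avg o n f + ((n : ℝ) + 1)⁻¹ * ((κ.op ^ (n + 1)) f o - f o) := by
  rw [avg_apply, avg_apply, ← mul_add]
  congr 1
  have h : ∀ k, (κ.op ^ k) (κ.op f) o = (κ.op ^ (k + 1)) f o := fun k => by rw [pow_succ]; rfl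
  rw [Finset.sum_congr rfl fun k _ => h k, Finset.sum_range_succ' (fun k => (κ.op ^ k) f o) n,
    Finset.sum_range_succ]
  simp

/-- Stationary probability distributions. -/
structure IsStat (π : S → ℝ) : Prop where
  nonneg : ∀ s, 0 ≤ π s
  total : HasSum π 1
  balance : ∀ t, HasSum (fun s => π s * κ.P s t) (π t)

variable {κ}

theorem summable_flow {π : S → ℝ} (h0 : ∀ s, 0 ≤ π s) (hs : Summable π) :
    Summable fun p : S × S => π p.1 * κ.P p.1 p.2 := by
  have hrow : ∀ s, HasSum (fun t => π s * κ.P s t) (π s) := fun s => by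
    have := (κ.hasSum_row (fun _ => 1) s).mul_left (π s)
    rw [congrFun (κ.op_const 1) s] at this
    simpa using this
  refine (summable_prod_of_nonneg fun p => mul_nonneg (h0 p.1) (κ.nonneg p.1 p.2)).2
    ⟨fun s => (hrow s).summable, ?_⟩
  exact hs.congr fun s => (hrow s).tsum_eq.symm

theorem IsStat.hasSum_op {π : S → ℝ} (hπ : κ.IsStat π) {u : S → ℝ} {B : ℝ}
    (hu : ∀ s, |u s| ≤ B) :
    Summable (fun s => π s * u s) ∧ HasSum (fun s => π s * κ.op u s) (∑' s, π s * u s) := by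
  have hF : Summable fun p : S × S => π p.1 * κ.P p.1 p.2 * u p.2 := by
    refine Summable.of_norm_bounded
      ((summable_flow (κ := κ) hπ.nonneg hπ.total.summable).mul_right B) fun p => ?_
    rw [norm_mul, Real.norm_of_nonneg (mul_nonneg (hπ.nonneg _) (κ.nonneg _ _))]
    exact mul_le_mul_of_nonneg_left (hu _) (mul_nonneg (hπ.nonneg _) (κ.nonneg _ _))
  have h1 : ∀ s, HasSum (fun t => π s * κ.P s t * u t) (π s * κ.op u s) := fun s => by
    simpa only [mul_assoc] using (κ.hasSum_row u s).mul_left (π s)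
  have h2 : ∀ t, HasSum (fun s => π s * κ.P s t * u t) (π t * u t) := fun t =>
    (hπ.balance t).mul_right (u t)
  have h3 := hF.hasSum.prod_fiberwise h1
  have h4 := ((Equiv.prodComm S S).hasSum_iff.2 hF.hasSum).prod_fiberwise h2
  exact ⟨h4.summable, h4.tsum_eq ▸ h3⟩

/-- Foster's bound: a drift inequality bounds a stationary mean. -/
theorem IsStat.drift_bound {π : S → ℝ} (hπ : κ.IsStat π) {f g : S → ℝ} {m C : ℝ}
    (hf : ∀ s, m ≤ f s) (hg : ∀ s, 0 ≤ g s) (hC : 0 ≤ C)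
    (h : ∀ s, κ.op f s ≤ f s - g s + C) :
    Summable (fun s => π s * g s) ∧ ∑' s, π s * g s ≤ C := by
  have key : ∀ F : Finset S, ∑ s ∈ F, π s * g s ≤ C := by
    classical
    intro F
    -- Stationarity can be used only for bounded functions, so f is cut off at a level M that it
    -- does not exceed on F. The cut-off keeps the drift where f ≤ M, and elsewhere it cannot
    -- increase.
    set M := ∑ s ∈ F, |f s| with hM
    have hFM : ∀ s ∈ F, f s ≤ M := fun s hs =>
      (le_abs_self _).trans (Finset.single_le_sum (fun t _ => abs_nonneg (f t)) hs)
    set u : S → ℝ := fun s => min (f s) M with hu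
    have hM0 : 0 ≤ M := Finset.sum_nonneg fun t _ => abs_nonneg (f t)
    have hub : ∀ s, |u s| ≤ |m| + M := fun s => by
      rw [abs_le]
      refine ⟨le_min ?_ ?_, (min_le_right _ _).trans ?_⟩
      · linarith [hf s, neg_abs_le m]
      · linarith [abs_nonneg m]
      · linarith [abs_nonneg m]
    obtain ⟨hs, ho⟩ := hπ.hasSum_op hub
    have hpt : ∀ s, π s * κ.op u s ≤ π s * u s - (if s ∈ F then π s * g s else 0) + π s * C := by
      intro s
      have : κ.op u s ≤ u s - (if s ∈ F then g s else 0) + C := by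
        by_cases hs : f s ≤ M
        · have h1 : κ.op u s ≤ κ.op f s := κ.op_mono (fun t => min_le_left _ _) s
          have h2 : u s = f s := min_eq_left hs
          have h3 : (if s ∈ F then g s else 0) ≤ g s := by split_ifs <;> simp [hg s]
          linarith [h s]
        · have h1 : κ.op u s ≤ κ.op (fun _ => M) s := κ.op_mono (fun t => min_le_right _ _) s
          rw [κ.op_const] at h1
          have h2 : u s = M := min_eq_right (not_le.1 hs).le
          rw [if_neg fun hsF => hs (hFM s hsF)]
          linarith
      have := mul_le_mul_of_nonneg_left this (hπ.nonneg s)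
      split_ifs at this ⊢ <;> linarith
    have hsum : HasSum (fun s => if s ∈ F then π s * g s else 0) (∑ s ∈ F, π s * g s) := by
      have : HasSum (fun s => if s ∈ F then π s * g s else 0)
          (∑ s ∈ F, if s ∈ F then π s * g s else 0) :=
        hasSum_sum_of_ne_finset_zero fun t ht => if_neg ht
      rwa [Finset.sum_congr rfl fun t ht => if_pos ht] at this
    have := hasSum_le hpt ho ((hs.hasSum.sub hsum).add (hπ.total.mul_right C))
    linarith
  have h0 : ∀ s, 0 ≤ π s * g s := fun s => mul_nonneg (hπ.nonneg s) (hg s)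
  exact ⟨summable_of_sum_le h0 key, Real.tsum_le_of_sum_le h0 key⟩

/-- Existence of a stationary distribution under a drift condition with finite sublevel sets. -/
theorem exists_isStat (o : S) {f g : S → ℝ} {C : ℝ} (hf : ∀ s, 0 ≤ f s) (hg : ∀ s, 0 ≤ g s)
    (h : ∀ s, κ.op f s ≤ f s - g s + C) (hfin : ∀ M : ℝ, {s | g s ≤ M}.Finite) :
    ∃ π, κ.IsStat π := by
  classical
  let x : ℕ → S → ℝ := fun n s => κ.avg o n (Pi.single s 1)
  have hsingle : ∀ s t : S, (0 : ℝ) ≤ (Pi.single s 1 : S → ℝ) t ∧ (Pi.single s 1 : S → ℝ) t ≤ 1 :=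
    fun s t => by by_cases hst : t = s <;> simp [hst]
  have hx0 : ∀ n s, 0 ≤ x n s := fun n s => by
    simpa only [avg_const] using κ.avg_mono o n (f := fun _ => 0) fun t => (hsingle s t).1
  have hx1 : ∀ n s, x n s ≤ 1 := fun n s => by
    simpa only [avg_const] using κ.avg_mono o n (g := fun _ => 1) fun t => (hsingle s t).2
  -- By compactness of the product of unit intervals, the averaged occupation probabilities converge
  -- pointwise along an ultrafilter.
  obtain ⟨π, -, hπ⟩ : ∃ π ∈ Set.pi Set.univ (fun _ : S => Set.Icc (0 : ℝ) 1),
      ((hyperfilter ℕ).map x : Filter (S → ℝ)) ≤ 𝓝 π :=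
    (isCompact_univ_pi fun _ => isCompact_Icc).ultrafilter_le_nhds ((hyperfilter ℕ).map x)
      (by
        refine le_principal_iff.2 (Ultrafilter.mem_map.2 (Filter.univ_mem' fun n => ?_))
        exact fun s _ => ⟨hx0 n s, hx1 n s⟩)
  have hlim : ∀ s, Tendsto (fun n => x n s) (hyperfilter ℕ) (𝓝 (π s)) :=
    tendsto_pi_nhds.1 hπ
  have hinv : Tendsto (fun n : ℕ => ((n : ℝ) + 1)⁻¹) (hyperfilter ℕ) (𝓝 0) := by
    have := (tendsto_one_div_add_atTop_nhds_zero_nat (𝕜 := ℝ)).mono_left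
      (Nat.hyperfilter_le_atTop)
    simpa using this
  have hlin : ∀ (n : ℕ) (c : S → ℝ) (F : Finset S),
      ∑ s ∈ F, c s * x n s = κ.avg o n (∑ s ∈ F, c s • Pi.single s 1) := fun n c F => by
    simp [x, map_sum]
  have hind : ∀ (c : S → ℝ) (F : Finset S) (t : S),
      (∑ s ∈ F, c s • (Pi.single s 1 : S → ℝ)) t = if t ∈ F then c t else 0 := fun c F t => by
    simp [Finset.sum_apply, Pi.single_apply]
  have hpi0 : ∀ s, 0 ≤ π s := fun s => ge_of_tendsto' (hlim s) fun n => hx0 n s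
  have hpi1 : ∀ F : Finset S, ∑ s ∈ F, π s ≤ 1 := fun F => by
    refine le_of_tendsto' (tendsto_finsetSum F fun s _ => hlim s) fun n => ?_
    have := hlin n (fun _ => 1) F
    simp only [one_mul] at this
    rw [this]
    refine (κ.avg_mono o n (g := fun _ => 1) fun t => ?_).trans (κ.avg_const o n 1).le
    rw [hind]; split_ifs <;> norm_num
  -- Averaging the drift inequality along the chain telescopes f and bounds the mean of g.
  have hgn : ∀ n, κ.avg o n g ≤ C + ((n : ℝ) + 1)⁻¹ * f o := fun n => by
    have h1 : κ.avg o n (κ.op f) ≤ κ.avg o n (f - g + fun _ => C) := κ.avg_mono o n h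
    rw [map_add, map_sub, avg_const, avg_op] at h1
    have h2 : 0 ≤ (κ.op ^ (n + 1)) f o := by
      simpa only [op_pow_const] using κ.op_pow_mono (n + 1) (f := fun _ => 0) hf o
    have h3 : (0 : ℝ) ≤ ((n : ℝ) + 1)⁻¹ := by positivity
    nlinarith [mul_nonneg h3 h2]
  -- Markov's inequality for g: the finite sublevel sets carry almost all the mass uniformly in
  -- time, so no mass escapes in the limit.
  have htight : ∀ M : ℝ, 0 < M → 1 - C / M ≤ ∑ s ∈ (hfin M).toFinset, π s := fun M hM => by
    have h1 : Tendsto (fun n : ℕ => 1 - (C + ((n : ℝ) + 1)⁻¹ * f o) / M) (hyperfilter ℕ)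
        (𝓝 (1 - (C + 0 * f o) / M)) :=
      tendsto_const_nhds.sub ((tendsto_const_nhds.add (hinv.mul_const _)).div_const _)
    rw [zero_mul, add_zero] at h1
    refine le_of_tendsto_of_tendsto' h1 (tendsto_finsetSum _ fun s _ => hlim s) fun n => ?_
    have := hlin n (fun _ => 1) (hfin M).toFinset
    simp only [one_mul] at this
    rw [this]
    have h2 := κ.avg_mono o n (f := (fun _ => (1 : ℝ)) - M⁻¹ • g)
      (g := ∑ s ∈ (hfin M).toFinset, (1 : ℝ) • (Pi.single s 1 : S → ℝ)) fun t => by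
        rw [hind]
        simp only [Pi.sub_apply, Pi.smul_apply, smul_eq_mul, Set.Finite.mem_toFinset,
          Set.mem_ofPred_eq]
        split_ifs with ht
        · linarith [mul_nonneg (inv_nonneg.2 hM.le) (hg t)]
        · rw [sub_nonpos, inv_mul_eq_div, one_le_div hM]; exact (not_le.1 ht).le
    rw [map_sub, map_smul, avg_const, smul_eq_mul] at h2
    simp only [one_smul] at h2 ⊢
    refine le_trans ?_ h2
    rw [div_eq_inv_mul]
    have := mul_le_mul_of_nonneg_left (hgn n) (inv_nonneg.2 hM.le)
    linarith
  have hsumm : Summable π := summable_of_sum_le hpi0 hpi1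
  have htot : ∑' s, π s = 1 := by
    refine le_antisymm (Real.tsum_le_of_sum_le hpi0 hpi1) ?_
    have h1 : Tendsto (fun n : ℕ => 1 - C / ((n : ℝ) + 1)) atTop (𝓝 (1 - 0)) :=
      tendsto_const_nhds.sub (by
        simpa [div_eq_mul_inv] using
          (tendsto_one_div_add_atTop_nhds_zero_nat (𝕜 := ℝ)).const_mul C)
    rw [sub_zero] at h1
    exact le_of_tendsto' h1 fun n => (htight _ (by positivity)).trans
      (hsumm.sum_le_tsum _ fun s _ => hpi0 s)
  -- A column may be infinite, so the pointwise limit yields only π P ≤ π at first. Both sides have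
  -- the same total mass, which forces equality below.
  have hsub : ∀ t (F : Finset S), ∑ s ∈ F, π s * κ.P s t ≤ π t := fun t F => by
    have h1 : Tendsto (fun n : ℕ => x n t + ((n : ℝ) + 1)⁻¹) (hyperfilter ℕ) (𝓝 (π t + 0)) :=
      (hlim t).add hinv
    rw [add_zero] at h1
    refine le_of_tendsto_of_tendsto' (tendsto_finsetSum F fun s _ => (hlim s).mul_const _) h1
      fun n => ?_
    rw [Finset.sum_congr rfl fun s _ => mul_comm (x n s) (κ.P s t), hlin n (fun s => κ.P s t)]
    have hop : ∀ s, κ.op (Pi.single t 1) s = κ.P s t := fun s => by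
      rw [op_apply, Finset.sum_eq_single t]
      · simp
      · intro b _ hb; simp [hb]
      · intro ht; simp [κ.supp s t ht]
    refine (κ.avg_mono o n (g := κ.op (Pi.single t 1)) fun s => ?_).trans ?_
    · rw [hind, hop]; split_ifs
      · rfl
      · exact κ.nonneg _ _
    · rw [avg_op]
      have h2 : (κ.op ^ (n + 1)) (Pi.single t 1) o ≤ 1 := by
        simpa only [op_pow_const] using
          κ.op_pow_mono (n + 1) (g := fun _ => 1) (fun s => (hsingle t s).2) o
      have h3 : (0 : ℝ) ≤ ((n : ℝ) + 1)⁻¹ := by positivity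
      have h4 := (hsingle t o).1
      have : ((n : ℝ) + 1)⁻¹ * ((κ.op ^ (n + 1)) (Pi.single t 1) o - (Pi.single t 1 : S → ℝ) o)
          ≤ ((n : ℝ) + 1)⁻¹ * 1 := mul_le_mul_of_nonneg_left (by linarith) h3
      show x n t + _ ≤ _
      linarith
  have hnn : ∀ s t, 0 ≤ π s * κ.P s t := fun s t => mul_nonneg (hpi0 s) (κ.nonneg s t)
  have hcol : ∀ t, Summable fun s => π s * κ.P s t := fun t =>
    summable_of_sum_le (fun s => hnn s t) (hsub t)
  refine ⟨π, hpi0, htot ▸ hsumm.hasSum, ?_⟩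
  have hle : ∀ t, ∑' s, π s * κ.P s t ≤ π t := fun t =>
    Real.tsum_le_of_sum_le (fun s => hnn s t) (hsub t)
  have hF := summable_flow (κ := κ) hpi0 hsumm
  have hrow : ∀ s, HasSum (fun t => π s * κ.P s t) (π s) := fun s => by
    have := (κ.hasSum_row (fun _ => 1) s).mul_left (π s)
    rw [congrFun (κ.op_const 1) s] at this
    simpa using this
  have h3 := hF.hasSum.prod_fiberwise hrow
  have h4 := ((Equiv.prodComm S S).hasSum_iff.2 hF.hasSum).prod_fiberwise
    fun t => (hcol t).hasSum
  have h5 := hsumm.hasSum.sub h4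
  rw [← h3.tsum_eq, sub_self, hasSum_zero_iff_of_nonneg fun t => sub_nonneg.2 (hle t)] at h5
  intro t
  have := congrFun h5 t
  simp only [Pi.zero_apply, sub_eq_zero] at this
  rw [this]
  exact (hcol t).hasSum

/-- Uniqueness of the stationary distribution when some state is reached from everywhere. -/
theorem IsStat.unique (o : S)
    (hreach : ∀ s, Relation.ReflTransGen (fun s t => 0 < κ.P s t) s o) {π₁ π₂ : S → ℝ}
    (h₁ : κ.IsStat π₁) (h₂ : κ.IsStat π₂) : π₁ = π₂ := by
  set δ : S → ℝ := fun s => π₁ s - π₂ s with hδ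
  have hδs : Summable δ := h₁.total.summable.sub h₂.total.summable
  have hδb : ∀ t, HasSum (fun s => δ s * κ.P s t) (δ t) := fun t => by
    simpa only [hδ, sub_mul] using (h₁.balance t).sub (h₂.balance t)
  have habs : Summable fun s => |δ s| := hδs.abs
  have hF := summable_flow (κ := κ) (fun s => abs_nonneg (δ s)) habs
  have hcol : ∀ t, Summable fun s => |δ s| * κ.P s t := fun t =>
    hF.prod_symm.prod_factor t
  have hle : ∀ t, |δ t| ≤ ∑' s, |δ s| * κ.P s t := fun t => by
    rw [← (hδb t).tsum_eq]
    have : ∀ s, |δ s| * κ.P s t = ‖δ s * κ.P s t‖ := fun s => by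
      rw [norm_mul, Real.norm_eq_abs, Real.norm_of_nonneg (κ.nonneg s t)]
    rw [tsum_congr this, ← Real.norm_eq_abs]
    exact norm_tsum_le_tsum_norm ((hcol t).congr this)
  have hrow : ∀ s, HasSum (fun t => |δ s| * κ.P s t) (|δ s|) := fun s => by
    have := (κ.hasSum_row (fun _ => 1) s).mul_left (|δ s|)
    rw [congrFun (κ.op_const 1) s] at this
    simpa using this
  have h3 := hF.hasSum.prod_fiberwise hrow
  have h4 := ((Equiv.prodComm S S).hasSum_iff.2 hF.hasSum).prod_fiberwise
    fun t => (hcol t).hasSum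
  have h5 := h4.sub habs.hasSum
  -- Here |δ| ≤ |δ| P holds pointwise with equal total masses, so |δ| is invariant too, and hence so
  -- are |δ| + δ and |δ| - δ.
  rw [← h3.tsum_eq, sub_self, hasSum_zero_iff_of_nonneg fun t => sub_nonneg.2 (hle t)] at h5
  have hbal : ∀ t, HasSum (fun s => |δ s| * κ.P s t) (|δ t|) := fun t => by
    have := congrFun h5 t
    simp only [Pi.zero_apply, sub_eq_zero] at this
    rw [← this]
    exact (hcol t).hasSum
  -- A nonnegative invariant function that is positive somewhere is positive at o. The functions |δ|
  -- + δ and |δ| - δ cannot both be positive there, so δ has constant sign; its total is zero.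
  have hpos : ∀ ε : ℝ, ∀ s, 0 < |δ s| + ε * δ s → (ε = 1 ∨ ε = -1) → 0 < |δ o| + ε * δ o := by
    intro ε s hs hε
    have hnn : ∀ s, 0 ≤ |δ s| + ε * δ s := fun s => by
      rcases hε with rfl | rfl
      · linarith [neg_abs_le (δ s)]
      · linarith [le_abs_self (δ s)]
    have hb : ∀ t, HasSum (fun s => (|δ s| + ε * δ s) * κ.P s t) (|δ t| + ε * δ t) := fun t => by
      simpa only [add_mul, mul_assoc] using (hbal t).add ((hδb t).mul_left ε)
    suffices ∀ b, Relation.ReflTransGen (fun s t => 0 < κ.P s t) s b → 0 < |δ b| + ε * δ b from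
      this o (hreach s)
    intro b hsb
    induction hsb with
    | refl => exact hs
    | @tail b c _ hbc ih =>
      refine (mul_pos ih hbc).trans_le ?_
      rw [← (hb c).tsum_eq]
      exact (hb c).summable.le_tsum b fun j _ => mul_nonneg (hnn j) (κ.nonneg _ _)
  have htot : HasSum δ 0 := by simpa using h₁.total.sub h₂.total
  have hcase : (∀ s, δ s ≤ 0) ∨ (∀ s, 0 ≤ δ s) := by
    by_contra hcon
    push Not at hcon
    obtain ⟨⟨s, hs⟩, ⟨t, ht⟩⟩ := hcon
    have a := hpos 1 s (by have := abs_nonneg (δ s); linarith) (Or.inl rfl)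
    have b := hpos (-1) t (by have := abs_nonneg (δ t); linarith) (Or.inr rfl)
    rcases le_total 0 (δ o) with h | h
    · rw [abs_of_nonneg h] at b; linarith
    · rw [abs_of_nonpos h] at a; linarith
  have hzero : δ = 0 := by
    rcases hcase with h | h
    · have h' : HasSum (fun s => - δ s) 0 := by simpa using htot.neg
      have := (hasSum_zero_iff_of_nonneg fun s => neg_nonneg.2 (h s)).1 h'
      funext s
      simpa using congrFun this s
    · exact (hasSum_zero_iff_of_nonneg h).1 htot
  funext s
  have := congrFun hzero s
  simpa [hδ, sub_eq_zero] using this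

end FinKernel

/-! ### The jump chain of a policy and Little's law -/

/-- The states that one arrival can lead to. -/
def box (s : Market) : Finset Market := Finset.range (s.1 + 2) ×ˢ Finset.range (s.2 + 2)

theorem mem_box {s t : Market} : t ∈ box s ↔ t.1 ≤ s.1 + 1 ∧ t.2 ≤ s.2 + 1 := by
  simp only [box, Finset.mem_product, Finset.mem_range]; omega

/-- Structural properties shared by the two matching policies. -/
structure IsPolicy (P : Kind → Market → Market → ℝ) : Prop where
  nonneg : ∀ k s t, 0 ≤ P k s t
  supp : ∀ k s t, t ∉ box s → P k s t = 0
  sum_one : ∀ k s, ∑ t ∈ box s, P k s t = 1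
  easy_le : ∀ s t, s.1 < t.1 → P Kind.E s t = 0
  leave : ∀ s : Market, 0 < s.1 → ∃ k t, 0 < P k s t ∧ t.1 < s.1

/-- The jump chain of the market. -/
noncomputable def IsPolicy.kernel {P : Kind → Market → Market → ℝ} (hP : IsPolicy P)
    {lamH lamE : ℝ} (hH : 0 < lamH) (hE : 0 < lamE) : FinKernel Market where
  P s t := (lamH * P Kind.H s t + lamE * P Kind.E s t) / (lamH + lamE)
  N := box
  nonneg s t := by
    have := hP.nonneg Kind.H s t
    have := hP.nonneg Kind.E s t
    positivity
  supp s t ht := by simp [hP.supp _ s t ht]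
  sum_one s := by
    rw [← Finset.sum_div, Finset.sum_add_distrib, ← Finset.mul_sum, ← Finset.mul_sum,
      hP.sum_one, hP.sum_one, mul_one, mul_one, div_self (by positivity)]

section

variable {P : Kind → Market → Market → ℝ} (hP : IsPolicy P)
    {lamH lamE : ℝ} (hH : 0 < lamH) (hE : 0 < lamE)

theorem IsPolicy.kernel_P (s t : Market) :
    (hP.kernel hH hE).P s t = (lamH * P Kind.H s t + lamE * P Kind.E s t) / (lamH + lamE) := rfl

theorem IsPolicy.kernel_op (f : Market → ℝ) (s : Market) :
    (hP.kernel hH hE).op f s = (lamH * ∑ t ∈ box s, P Kind.H s t * f t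
      + lamE * ∑ t ∈ box s, P Kind.E s t * f t) / (lamH + lamE) := by
  rw [FinKernel.op_apply, Finset.mul_sum, Finset.mul_sum, ← Finset.sum_add_distrib,
    Finset.sum_div]
  exact Finset.sum_congr rfl fun t _ => by rw [hP.kernel_P]; ring

theorem hasSum_pt (π : Market → ℝ) (t : Market) : HasSum (fun s => π s * pt s t) (π t) := by
  have := hasSum_single (f := fun s => π s * pt s t) t fun s hs => by simp [pt, hs.symm]
  simpa [pt] using this

/-- Arrivals come at the same total rate in every state, so the rate matrix is (lamH + lamE)(P - I)
with P the jump kernel, and the stationary laws agree. -/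
theorem IsPolicy.isSteadyState_iff (π : Market → ℝ) :
    IsSteadyState (rateMatrix lamH lamE P) π ↔ (hP.kernel hH hE).IsStat π := by
  have hl : lamH + lamE ≠ 0 := by positivity
  have hQ : ∀ s t, π s * rateMatrix lamH lamE P s t
      = (lamH + lamE) * (π s * (hP.kernel hH hE).P s t - π s * pt s t) := fun s t => by
    rw [rateMatrix, hP.kernel_P]; field_simp; ring
  constructor
  · rintro ⟨h0, h1, h2⟩
    refine ⟨h0, h1, fun t => ?_⟩
    have := ((h2 t).mul_left (lamH + lamE)⁻¹).add (hasSum_pt π t)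
    rw [mul_zero, zero_add] at this
    refine this.congr_fun fun s => ?_
    rw [hQ]; field_simp; ring
  · rintro ⟨h0, h1, h2⟩
    refine ⟨h0, h1, fun t => ?_⟩
    have := (((h2 t).sub (hasSum_pt π t)).mul_left (lamH + lamE))
    rw [sub_self, mul_zero] at this
    exact this.congr_fun fun s => (hQ s t)

/-- The probability that one tagged `H` agent among those at `s` survives an arrival that moves
the market to `t`, jointly with that move. -/
noncomputable def survive (lamH lamE : ℝ) (P : Kind → Market → Market → ℝ) (s t : Market) : ℝ :=
  (lamH * P Kind.H s t + lamE * P Kind.E s t) / (lamH + lamE) * ((min s.1 t.1 : ℕ) / (s.1 : ℝ))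

include hP hH hE

theorem IsPolicy.survive_nonneg (s t : Market) : 0 ≤ survive lamH lamE P s t :=
  mul_nonneg ((hP.kernel hH hE).nonneg s t) (by positivity)

theorem IsPolicy.survive_le (s t : Market) :
    survive lamH lamE P s t ≤ (hP.kernel hH hE).P s t := by
  refine mul_le_of_le_one_right ((hP.kernel hH hE).nonneg s t) (div_le_one_of_le₀ ?_ (by positivity))
  exact_mod_cast min_le_left _ _

theorem IsPolicy.stay_nonneg (n : ℕ) (s : Market) : 0 ≤ stay lamH lamE P n s := by
  induction n generalizing s with
  | zero => simp [stay]
  | succ n ih =>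
    rw [stay]
    exact tsum_nonneg fun t => mul_nonneg (hP.survive_nonneg hH hE s t) (ih t)

theorem IsPolicy.ofReal_stay_succ (n : ℕ) (s : Market) :
    ENNReal.ofReal (stay lamH lamE P (n + 1) s) =
      ∑' t, ENNReal.ofReal (survive lamH lamE P s t) * ENNReal.ofReal (stay lamH lamE P n t) := by
  rw [stay, ENNReal.ofReal_tsum_of_nonneg]
  · exact tsum_congr fun t => ENNReal.ofReal_mul (hP.survive_nonneg hH hE s t)
  · exact fun t => mul_nonneg (hP.survive_nonneg hH hE s t) (hP.stay_nonneg hH hE n t)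
  · refine summable_of_ne_finset_zero (s := box s) fun t ht => ?_
    simp [hP.supp _ s t ht]

theorem IsPolicy.stay_one_lt {s : Market} (hs : 0 < s.1) : stay lamH lamE P 1 s < 1 := by
  have h1 : stay lamH lamE P 1 s = ∑ t ∈ box s, survive lamH lamE P s t := by
    rw [stay, tsum_eq_sum (s := box s) fun t ht => by simp [hP.supp _ s t ht]]
    exact Finset.sum_congr rfl fun t _ => by simp [stay, survive]
  rw [h1, ← (hP.kernel hH hE).sum_one s]
  obtain ⟨k, t, hk, ht⟩ := hP.leave s hs
  have htb : t ∈ box s := by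
    by_contra h
    exact hk.ne' (hP.supp k s t h)
  refine Finset.sum_lt_sum (fun t _ => hP.survive_le hH hE s t) ⟨t, htb, ?_⟩
  have hpos : 0 < (hP.kernel hH hE).P s t := by
    rw [hP.kernel_P]
    have a := hP.nonneg Kind.H s t
    have b := hP.nonneg Kind.E s t
    cases k <;> positivity
  refine mul_lt_of_lt_one_right hpos ?_
  rw [div_lt_one (by exact_mod_cast hs)]
  exact_mod_cast (min_le_right _ _).trans_lt ht

/-- Flow balance of the `H` agents, counted with multiplicity: those present at `t` either stayed or
have just joined. -/
theorem IsPolicy.flow_balance {π : Market → ℝ} (hπ : (hP.kernel hH hE).IsStat π) (t : Market) :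
    ENNReal.ofReal (π t * t.1) =
      (∑' s : Market, ENNReal.ofReal (π s * s.1) * ENNReal.ofReal (survive lamH lamE P s t)) +
      ∑' s : Market, ENNReal.ofReal (π s) *
        (if t.1 = s.1 + 1 then ENNReal.ofReal (lamH / (lamH + lamE) * P Kind.H s t) else 0) := by
  rw [← ((hπ.balance t).mul_right (t.1 : ℝ)).tsum_eq, ENNReal.ofReal_tsum_of_nonneg
    (fun s => mul_nonneg (mul_nonneg (hπ.nonneg s) ((hP.kernel hH hE).nonneg s t)) (by positivity))
    ((hπ.balance t).mul_right _).summable, ← ENNReal.tsum_add]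
  refine tsum_congr fun s => ?_
  have hPH := hP.nonneg Kind.H s t
  rw [← ENNReal.ofReal_mul (mul_nonneg (hπ.nonneg s) (by positivity))]
  have hif : (if t.1 = s.1 + 1 then ENNReal.ofReal (lamH / (lamH + lamE) * P Kind.H s t) else 0)
      = ENNReal.ofReal (if t.1 = s.1 + 1 then lamH / (lamH + lamE) * P Kind.H s t else 0) := by
    split_ifs <;> simp
  have hnn : 0 ≤ (if t.1 = s.1 + 1 then lamH / (lamH + lamE) * P Kind.H s t else 0) := by
    split_ifs <;> positivity
  rw [hif, ← ENNReal.ofReal_mul (hπ.nonneg s), ← ENNReal.ofReal_add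
    (mul_nonneg (mul_nonneg (hπ.nonneg s) (by positivity)) (hP.survive_nonneg hH hE s t))
    (mul_nonneg (hπ.nonneg s) hnn)]
  congr 1
  rw [survive, hP.kernel_P]
  -- The identity behind the balance: for a possible move, t.1 is min s.1 t.1, plus one exactly when
  -- an `H` agent joins. For s.1 = 0 the quotient in `survive` is 0 / 0 = 0, but its weight π s *
  -- s.1 vanishes as well.
  rcases lt_trichotomy t.1 (s.1 + 1) with h | h | h
  · rw [if_neg h.ne, min_eq_right (by omega : t.1 ≤ s.1)]
    rcases Nat.eq_zero_or_pos s.1 with h0 | h0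
    · have : t.1 = 0 := by omega
      simp [this]
    · have : (s.1 : ℝ) ≠ 0 := by exact_mod_cast h0.ne'
      field_simp; ring
  · rw [if_pos h, min_eq_left (by omega : s.1 ≤ t.1), hP.easy_le s t (by omega), h]
    have hl : lamH + lamE ≠ 0 := by positivity
    rcases Nat.eq_zero_or_pos s.1 with h0 | h0
    · simp only [h0]; push_cast; ring
    · have : (s.1 : ℝ) ≠ 0 := by exact_mod_cast h0.ne'
      push_cast
      field_simp; ring
  · have : t ∉ box s := fun hb => by have := (mem_box.1 hb).1; omega
    simp [hP.supp _ s t this]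

/-- Little's law. -/
theorem IsPolicy.avgWaitH_eq
    (hπ : (hP.kernel hH hE).IsStat (steadyState (rateMatrix lamH lamE P)))
    (hs : Summable fun s : Market => steadyState (rateMatrix lamH lamE P) s * s.1) :
    avgWaitH lamH lamE P =
      ENNReal.ofReal ((∑' s : Market, steadyState (rateMatrix lamH lamE P) s * s.1) / lamH) := by
  unfold avgWaitH
  set π := steadyState (rateMatrix lamH lamE P) with hπdef
  set ν : Market → ℝ≥0∞ := fun t => ENNReal.ofReal (π t * t.1) with hν
  set K : Market → Market → ℝ≥0∞ := fun s t => ENNReal.ofReal (survive lamH lamE P s t) with hK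
  set st : ℕ → Market → ℝ≥0∞ := fun n s => ENNReal.ofReal (stay lamH lamE P n s) with hst
  set m : Market → ℝ≥0∞ := fun t => ∑' s : Market, ENNReal.ofReal (π s) *
        (if t.1 = s.1 + 1 then ENNReal.ofReal (lamH / (lamH + lamE) * P Kind.H s t) else 0) with hm
  have hflow : ∀ t, ν t = (∑' s, ν s * K s t) + m t := hP.flow_balance hH hE hπ
  have hst0 : ∀ s, st 0 s = 1 := fun s => by simp [hst, stay]
  have hsts : ∀ n s, st (n + 1) s = ∑' t, K s t * st n t := hP.ofReal_stay_succ hH hE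
  -- `row n` is ν Kⁿ: of the `H` agents present at stationarity, those still waiting after n
  -- arrivals. Dually, `st n` is Kⁿ applied to 1.
  let row : ℕ → Market → ℝ≥0∞ := fun n => Nat.rec ν (fun _ r t => ∑' s, r s * K s t) n
  have hrow0 : row 0 = ν := rfl
  have hrows : ∀ n t, row (n + 1) t = ∑' s, row n s * K s t := fun n t => rfl
  have hdual : ∀ (ρ : Market → ℝ≥0∞) k,
      ∑' s, ρ s * st (k + 1) s = ∑' t, (∑' s, ρ s * K s t) * st k t := fun ρ k => by
    simp only [hsts, ← ENNReal.tsum_mul_left, ← ENNReal.tsum_mul_right]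
    rw [ENNReal.tsum_comm]
    simp only [mul_assoc]
  have hshift : ∀ k n, ∑' s, row n s * st k s = ∑' s, row (n + k) s := fun k => by
    induction k with
    | zero => intro n; simp [hst0]
    | succ k ih =>
      intro n
      rw [hdual, show n + (k + 1) = (n + 1) + k by ring, ← ih (n + 1)]
  have ha0 : ∑' s, row 0 s = ENNReal.ofReal (∑' s : Market, π s * s.1) := by
    rw [hrow0, ENNReal.ofReal_tsum_of_nonneg (fun s => mul_nonneg (hπ.nonneg s) (by positivity)) hs]
  have hfin : ∑' s, row 0 s ≠ ∞ := ha0 ▸ ENNReal.ofReal_ne_top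
  have hle : ∀ n t, row n t ≤ ν t := fun n => by
    induction n with
    | zero => intro t; rfl
    | succ n ih =>
      intro t
      rw [hrows, hflow t]
      exact (ENNReal.tsum_le_tsum fun s => mul_le_mul_left (ih s) _).trans le_self_add
  have hst1 : ∀ s : Market, 0 < s.1 → st 1 s < 1 := fun s h0 => by
    have := hP.stay_one_lt hH hE h0
    rw [hst]; simpa using this
  -- At a state with h > 0 a fixed fraction c of the mass is lost at each step. The losses sum to at
  -- most the finite initial mass, so the mass at that state tends to zero.
  have hzero : ∀ s, Tendsto (fun n => row n s) atTop (𝓝 0) := fun s => by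
    rcases Nat.eq_zero_or_pos s.1 with h0 | h0
    · have : ∀ n, row n s = 0 := fun n => by
        have := hle n s
        simpa [hν, h0] using this
      simp [this]
    · set c := 1 - st 1 s with hc
      have hc0 : c ≠ 0 := (tsub_pos_of_lt (hst1 s h0)).ne'
      have hstep : ∀ n, row n s * c + ∑' s, row (n + 1) s ≤ ∑' s, row n s := fun n => by
        rw [← hshift 1 n]
        have h1 : ∀ u, (if u = s then row n s * c else 0) + row n u * st 1 u ≤ row n u := fun u => by
          split_ifs with hu
          · rw [hu, ← mul_add, hc, tsub_add_cancel_of_le (hst1 s h0).le, mul_one]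
          · rw [zero_add]
            rcases Nat.eq_zero_or_pos u.1 with h | h
            · have := hle n u
              have : row n u = 0 := by simpa [hν, h] using this
              simp [this]
            · exact mul_le_of_le_one_right zero_le (hst1 u h).le
        have h2 := ENNReal.tsum_le_tsum h1
        rwa [ENNReal.tsum_add, tsum_ite_eq] at h2
      have hsum : ∀ N, ∑ n ∈ Finset.range N, row n s * c + ∑' s, row N s ≤ ∑' s, row 0 s :=
        fun N => by
          induction N with
          | zero => simp
          | succ N ih =>
            rw [Finset.sum_range_succ, add_assoc]
            exact (add_le_add_right (hstep N) _).trans ih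
      have hts : ∑' n, row n s * c ≠ ∞ := by
        refine ne_top_of_le_ne_top hfin (ENNReal.tsum_le_of_sum_range_le fun N => ?_)
        exact le_self_add.trans (hsum N)
      have h1 := ENNReal.tendsto_atTop_zero_of_tsum_ne_top hts
      have hct : c ≠ ∞ := ne_top_of_le_ne_top ENNReal.one_ne_top tsub_le_self
      have h2 := ENNReal.Tendsto.mul_const (b := c⁻¹) h1 (Or.inr (ENNReal.inv_ne_top.2 hc0))
      rw [zero_mul] at h2
      refine h2.congr fun n => ?_
      rw [mul_assoc, ENNReal.mul_inv_cancel hc0 hct, mul_one]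
  -- The summable ν dominates every row, so pointwise convergence carries over to the total mass.
  have hlim : Tendsto (fun n => ∑' s, row n s) atTop (𝓝 0) := by
    have := MeasureTheory.tendsto_lintegral_of_dominated_convergence
      (μ := MeasureTheory.Measure.count) (F := row) (f := fun _ => 0) ν
      (fun n => measurable_of_countable _) (fun n => .of_forall (hle n))
      (by rw [MeasureTheory.lintegral_count]; exact hfin) (.of_forall hzero)
    simpa only [MeasureTheory.lintegral_count, tsum_zero] using this
  -- Iterating ν = ν K + m: the agents present now are those who joined during the last N arrivals
  -- and stayed, and those who were present before.
  have hdec : ∀ N, ∑ n ∈ Finset.range N, (∑' t, m t * st n t) + ∑' s, row N s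
      = ∑' s, row 0 s := fun N => by
    induction N with
    | zero => simp
    | succ N ih =>
      rw [← ih, Finset.sum_range_succ, add_assoc]
      congr 1
      have h1 := hshift N 0
      have h2 := hshift (N + 1) 0
      rw [zero_add] at h1 h2
      rw [← h1, ← h2, hdual, hrow0, ← ENNReal.tsum_add]
      refine tsum_congr fun t => ?_
      rw [← add_mul, add_comm (m t), ← hflow]
  have hmain : ∑' n, ∑' t, m t * st n t = ENNReal.ofReal (∑' s : Market, π s * s.1) := by
    rw [← ha0]
    have h1 := (ENNReal.tendsto_nat_tsum fun n => ∑' t, m t * st n t).add hlim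
    rw [add_zero] at h1
    exact tendsto_nhds_unique h1 (tendsto_const_nhds.congr fun N => (hdec N).symm)
  have hlam : ENNReal.ofReal lamH ≠ 0 := (ENNReal.ofReal_pos.2 hH).ne'
  rw [ENNReal.ofReal_div_of_pos hH, ← hmain, ENNReal.eq_div_iff hlam ENNReal.ofReal_ne_top]
  have hterm : ∀ s t : Market, ENNReal.ofReal lamH * (ENNReal.ofReal (π s) *
      (if t.1 = s.1 + 1 then ENNReal.ofReal (P Kind.H s t) * remainingWait lamH lamE P t else 0))
      = ∑' n, ENNReal.ofReal (π s) * (if t.1 = s.1 + 1 then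
          ENNReal.ofReal (lamH / (lamH + lamE) * P Kind.H s t) else 0) * st n t := fun s t => by
    have hPH := hP.nonneg Kind.H s t
    split_ifs
    · rw [ENNReal.tsum_mul_left, remainingWait]
      have : ∀ n, ENNReal.ofReal (stay lamH lamE P n t / (lamH + lamE))
          = ENNReal.ofReal (lamH + lamE)⁻¹ * st n t := fun n => by
        rw [div_eq_inv_mul, ENNReal.ofReal_mul (by positivity)]
      rw [tsum_congr this, ENNReal.tsum_mul_left, div_eq_mul_inv, mul_assoc lamH,
        ENNReal.ofReal_mul hH.le, ENNReal.ofReal_mul (by positivity)]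
      ring
    · simp
  rw [← ENNReal.tsum_mul_left]
  simp only [← ENNReal.tsum_mul_left, hterm]
  simp only [hm, ← ENNReal.tsum_mul_right]
  rw [ENNReal.tsum_comm]
  calc _ = ∑' (t : Market) (n : ℕ) (s : Market), ENNReal.ofReal (π s) * (if t.1 = s.1 + 1 then
          ENNReal.ofReal (lamH / (lamH + lamE) * P Kind.H s t) else 0) * st n t :=
        tsum_congr fun t => ENNReal.tsum_comm
    _ = _ := ENNReal.tsum_comm

end

/-! ### Search probabilities and elementary bounds -/

theorem find_zero (p : ℝ) : find p 0 = 0 := by simp [find]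

theorem find_nonneg {p : ℝ} (h0 : 0 ≤ p) (h1 : p ≤ 1) (n : ℕ) : 0 ≤ find p n :=
  sub_nonneg.2 (pow_le_one₀ (by linarith) (by linarith))

theorem find_le_one {p : ℝ} (h1 : p ≤ 1) (n : ℕ) : find p n ≤ 1 :=
  sub_le_self _ (pow_nonneg (by linarith) n)

theorem find_pos {p : ℝ} (h0 : 0 < p) (h1 : p ≤ 1) {n : ℕ} (hn : n ≠ 0) : 0 < find p n :=
  sub_pos.2 (pow_lt_one₀ (by linarith) (by linarith) hn)

theorem find_le_mul {p : ℝ} (h1 : p ≤ 1) (n : ℕ) : find p n ≤ p * n := by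
  have := one_add_mul_le_pow (a := -p) (by linarith) n
  rw [find, sub_eq_add_neg 1 p]; linarith

theorem pt_nonneg (s t : Market) : 0 ≤ pt s t := by unfold pt; split_ifs <;> norm_num

theorem sum_pt_mul {A : Finset Market} {s : Market} (hs : s ∈ A) (f : Market → ℝ) :
    ∑ t ∈ A, pt s t * f t = f s := by
  simp [pt, hs]

theorem acceptProb_pos {pH pE : ℝ} (hH : 0 < pH) (hE : 0 < pE) (k : Kind) :
    0 < acceptProb pH pE k := by cases k <;> assumption

theorem acceptProb_le_one {pH pE : ℝ} (hH : pH ≤ 1) (hE : pE ≤ 1) (k : Kind) :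
    acceptProb pH pE k ≤ 1 := by cases k <;> assumption

theorem finite_sublevel {g : Market → ℝ} (hg : ∀ s, (s.1 : ℝ) + s.2 ≤ g s) (M : ℝ) :
    {s | g s ≤ M}.Finite := by
  refine (Set.Finite.prod (Set.finite_Iic ⌊M⌋₊) (Set.finite_Iic ⌊M⌋₊)).subset fun s hs => ?_
  have h1 : g s ≤ M := hs
  have h2 := hg s
  have h3 : (0 : ℝ) ≤ s.1 := by positivity
  have h4 : (0 : ℝ) ≤ s.2 := by positivity
  exact ⟨Nat.le_floor (by linarith), Nat.le_floor (by linarith)⟩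

/-- `n * μ ^ n` is bounded. -/
theorem exists_mul_pow_le {μ : ℝ} (h0 : 0 ≤ μ) (h1 : μ < 1) :
    ∃ M : ℝ, 0 ≤ M ∧ ∀ n : ℕ, (n : ℝ) * μ ^ n ≤ M := by
  obtain ⟨M, hM⟩ := (tendsto_self_mul_const_pow_of_lt_one h0 h1).bddAbove_range
  have h : ∀ n : ℕ, (n : ℝ) * μ ^ n ≤ M := fun n => hM ⟨n, rfl⟩
  exact ⟨M, by simpa using h 0, h⟩

/-! ### BilateralMatch(H): steady state and second-order drift -/

section Bilateral

variable {pH pE : ℝ} (hH : 0 < pH) (hH1 : pH ≤ 1) (hE : 0 < pE) (hE1 : pE ≤ 1)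

theorem sum_bilateral (pH pE : ℝ) (k : Kind) (s : Market) (f : Market → ℝ) :
    ∑ t ∈ box s, bilateralMatchH pH pE k s t * f t =
      find (acceptProb pH pE k * pH) s.1 * f (s.1 - 1, s.2)
      + (1 - find (acceptProb pH pE k * pH) s.1) * find (acceptProb pH pE k * pE) s.2
        * f (s.1, s.2 - 1)
      + (1 - find (acceptProb pH pE k * pH) s.1) * (1 - find (acceptProb pH pE k * pE) s.2)
        * f (join k s) := by
  have h1 : (s.1 - 1, s.2) ∈ box s := mem_box.2 ⟨by dsimp only; omega, by dsimp only; omega⟩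
  have h2 : (s.1, s.2 - 1) ∈ box s := mem_box.2 ⟨by dsimp only; omega, by dsimp only; omega⟩
  have h3 : join k s ∈ box s := mem_box.2 (by cases k <;> simp [join])
  rw [← sum_pt_mul h1 f, ← sum_pt_mul h2 f, ← sum_pt_mul h3 f, Finset.mul_sum, Finset.mul_sum,
    Finset.mul_sum, ← Finset.sum_add_distrib, ← Finset.sum_add_distrib]
  exact Finset.sum_congr rfl fun t _ => by simp only [bilateralMatchH]; ring

include hH hH1 hE hE1

theorem find_accept_mul_nonneg (k : Kind) {q : ℝ} (hq : 0 < q) (hq1 : q ≤ 1) (n : ℕ) :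
    0 ≤ find (acceptProb pH pE k * q) n ∧ find (acceptProb pH pE k * q) n ≤ 1 := by
  have h1 := acceptProb_pos hH hE k
  have h2 := acceptProb_le_one hH1 hE1 k
  have h3 : acceptProb pH pE k * q ≤ 1 := mul_le_one₀ h2 hq.le hq1
  exact ⟨find_nonneg (by positivity) h3 n, find_le_one h3 n⟩

theorem isPolicy_bilateral : IsPolicy (bilateralMatchH pH pE) where
  nonneg k s t := by
    obtain ⟨a0, a1⟩ := find_accept_mul_nonneg hH hH1 hE hE1 k hH hH1 s.1
    obtain ⟨b0, b1⟩ := find_accept_mul_nonneg hH hH1 hE hE1 k hE hE1 s.2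
    have := pt_nonneg
    simp only [bilateralMatchH]
    exact add_nonneg (add_nonneg (mul_nonneg a0 (this _ _))
      (mul_nonneg (mul_nonneg (sub_nonneg.2 a1) b0) (this _ _)))
      (mul_nonneg (mul_nonneg (sub_nonneg.2 a1) (sub_nonneg.2 b1)) (this _ _))
  supp k s t ht := by
    rw [mem_box] at ht
    have h1 : pt (s.1 - 1, s.2) t = 0 := if_neg fun h => ht (by subst h; dsimp only; omega)
    have h2 : pt (s.1, s.2 - 1) t = 0 := if_neg fun h => ht (by subst h; dsimp only; omega)
    have h3 : pt (join k s) t = 0 := if_neg fun h => ht (by subst h; cases k <;> simp [join])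
    simp [bilateralMatchH, h1, h2, h3]
  sum_one k s := by
    have := sum_bilateral pH pE k s fun _ => 1
    simp only [mul_one] at this
    rw [this]; ring
  easy_le s t ht := by
    have h1 : pt (s.1 - 1, s.2) t = 0 := if_neg fun h => by subst h; dsimp only at ht; omega
    have h2 : pt (s.1, s.2 - 1) t = 0 := if_neg fun h => by subst h; dsimp only at ht; omega
    have h3 : pt (join Kind.E s) t = 0 := if_neg fun h => by subst h; simp [join] at ht
    simp [bilateralMatchH, h1, h2, h3]
  leave s hs := by
    refine ⟨Kind.H, (s.1 - 1, s.2), ?_, by dsimp only; omega⟩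
    obtain ⟨a0, a1⟩ := find_accept_mul_nonneg hH hH1 hE hE1 Kind.H hH hH1 s.1
    obtain ⟨b0, b1⟩ := find_accept_mul_nonneg hH hH1 hE hE1 Kind.H hE hE1 s.2
    have hpos : 0 < find (acceptProb pH pE Kind.H * pH) s.1 :=
      find_pos (mul_pos hH hH) (mul_le_one₀ hH1 hH.le hH1) hs.ne'
    have := pt_nonneg
    have h1 : pt (s.1 - 1, s.2) (s.1 - 1, s.2) = 1 := if_pos rfl
    simp only [bilateralMatchH]
    rw [h1, mul_one]
    exact add_pos_of_pos_of_nonneg (add_pos_of_pos_of_nonneg hpos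
      (mul_nonneg (mul_nonneg (sub_nonneg.2 a1) b0) (this _ _)))
      (mul_nonneg (mul_nonneg (sub_nonneg.2 a1) (sub_nonneg.2 b1)) (this _ _))

variable {lamH lamE : ℝ} (hlH : 0 < lamH) (hlE : 0 < lamE)

theorem bilateral_reach (s : Market) : Relation.ReflTransGen
    (fun s t => 0 < ((isPolicy_bilateral hH hH1 hE hE1).kernel hlH hlE).P s t) s (0, 0) := by
  have hpol := isPolicy_bilateral hH hH1 hE hE1
  have key : ∀ (k : Kind) (s t : Market), 0 < bilateralMatchH pH pE k s t →
      0 < ((isPolicy_bilateral hH hH1 hE hE1).kernel hlH hlE).P s t := fun k s t h => by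
    rw [hpol.kernel_P]
    have a := hpol.nonneg Kind.H s t
    have b := hpol.nonneg Kind.E s t
    cases k <;> positivity
  have hE0 : ∀ e : ℕ, Relation.ReflTransGen
      (fun s t => 0 < ((isPolicy_bilateral hH hH1 hE hE1).kernel hlH hlE).P s t) (0, e) (0, 0) := by
    intro e
    induction e with
    | zero => exact .refl
    | succ e ih =>
      refine Relation.ReflTransGen.head (key Kind.E _ _ ?_) ih
      obtain ⟨b0, b1⟩ := find_accept_mul_nonneg hH hH1 hE hE1 Kind.E hE hE1 (e + 1)
      have hpos : 0 < find (acceptProb pH pE Kind.E * pE) (e + 1) :=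
        find_pos (mul_pos hE hE) (mul_le_one₀ hE1 hE.le hE1) (by omega)
      have h1 : pt (0, e) (0, e) = 1 := if_pos rfl
      simp only [bilateralMatchH, find_zero, Nat.add_sub_cancel, h1]
      have := mul_nonneg (sub_nonneg.2 b1) (pt_nonneg (join Kind.E (0, e + 1)) (0, e))
      linarith
  obtain ⟨h, e⟩ := s
  induction h with
  | zero => exact hE0 e
  | succ h ih =>
    refine Relation.ReflTransGen.head (key Kind.H _ _ ?_) ih
    obtain ⟨a0, a1⟩ := find_accept_mul_nonneg hH hH1 hE hE1 Kind.H hH hH1 (h + 1)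
    obtain ⟨b0, b1⟩ := find_accept_mul_nonneg hH hH1 hE hE1 Kind.H hE hE1 e
    have hpos : 0 < find (acceptProb pH pE Kind.H * pH) (h + 1) :=
      find_pos (mul_pos hH hH) (mul_le_one₀ hH1 hH.le hH1) (by omega)
    have h1 : pt (h, e) (h, e) = 1 := if_pos rfl
    simp only [bilateralMatchH, Nat.add_sub_cancel, h1, mul_one]
    exact add_pos_of_pos_of_nonneg (add_pos_of_pos_of_nonneg hpos
      (mul_nonneg (mul_nonneg (sub_nonneg.2 a1) b0) (pt_nonneg _ _)))
      (mul_nonneg (mul_nonneg (sub_nonneg.2 a1) (sub_nonneg.2 b1)) (pt_nonneg _ _))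

/-- With n agents waiting, an arrival moves n by one, up with some probability u ≤ (1 - p²)ⁿ. The
mean of the new square is n² - 2n + 1 + 4nu, and nu is bounded. -/
theorem bilateral_foster : ∃ C : ℝ, 0 ≤ C ∧ ∀ s : Market,
    ((isPolicy_bilateral hH hH1 hE hE1).kernel hlH hlE).op
      (fun s => ((s.1 : ℝ) + s.2) ^ 2) s ≤ ((s.1 : ℝ) + s.2) ^ 2 - ((s.1 : ℝ) + s.2) + C := by
  set p := min pH pE with hp
  have hp0 : 0 < p := lt_min hH hE
  have hp1 : p ≤ 1 := (min_le_left _ _).trans hH1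
  obtain ⟨M, hM0, hM⟩ := exists_mul_pow_le (μ := 1 - p * p)
    (by nlinarith) (by nlinarith)
  refine ⟨1 + 4 * M, by positivity, fun s => ?_⟩
  have key : ∀ k, ∑ t ∈ box s, bilateralMatchH pH pE k s t * ((t.1 : ℝ) + t.2) ^ 2
      ≤ ((s.1 : ℝ) + s.2) ^ 2 - ((s.1 : ℝ) + s.2) + (1 + 4 * M) := fun k => by
    rw [sum_bilateral pH pE k s fun t => ((t.1 : ℝ) + t.2) ^ 2]
    have hacc : p ≤ acceptProb pH pE k := by
      cases k
      · exact min_le_left _ _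
      · exact min_le_right _ _
    have hacc1 := acceptProb_le_one hH1 hE1 k
    have hu1 : 1 - find (acceptProb pH pE k * pH) s.1 ≤ (1 - p * p) ^ s.1 := by
      rw [find, sub_sub_cancel]
      have : p * p ≤ acceptProb pH pE k * pH :=
        mul_le_mul hacc (min_le_left _ _) hp0.le (hp0.le.trans hacc)
      exact pow_le_pow_left₀ (by nlinarith) (by linarith) _
    have hu2 : 1 - find (acceptProb pH pE k * pE) s.2 ≤ (1 - p * p) ^ s.2 := by
      rw [find, sub_sub_cancel]
      have : p * p ≤ acceptProb pH pE k * pE :=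
        mul_le_mul hacc (min_le_right _ _) hp0.le (hp0.le.trans hacc)
      exact pow_le_pow_left₀ (by nlinarith) (by linarith) _
    have ha0 : find (acceptProb pH pE k * pH) s.1 * (((s.1 - 1 : ℕ) : ℝ) + s.2) ^ 2
        = find (acceptProb pH pE k * pH) s.1 * ((s.1 : ℝ) + s.2 - 1) ^ 2 := by
      rcases Nat.eq_zero_or_pos s.1 with h | h
      · simp [h, find_zero]
      · rw [Nat.cast_sub h]; push_cast; ring
    have hb0 : find (acceptProb pH pE k * pE) s.2 * ((s.1 : ℝ) + ((s.2 - 1 : ℕ) : ℝ)) ^ 2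
        = find (acceptProb pH pE k * pE) s.2 * ((s.1 : ℝ) + s.2 - 1) ^ 2 := by
      rcases Nat.eq_zero_or_pos s.2 with h | h
      · simp [h, find_zero]
      · rw [Nat.cast_sub h]; push_cast; ring
    have hj : (((join k s).1 : ℝ) + (join k s).2) = (s.1 : ℝ) + s.2 + 1 := by
      cases k <;> simp [join] <;> ring
    obtain ⟨-, a1⟩ := find_accept_mul_nonneg hH hH1 hE hE1 k hH hH1 s.1
    obtain ⟨-, b1⟩ := find_accept_mul_nonneg hH hH1 hE hE1 k hE hE1 s.2
    rw [hj]
    dsimp only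
    rw [ha0, mul_assoc, hb0]
    generalize find (acceptProb pH pE k * pH) s.1 = a at *
    generalize find (acceptProb pH pE k * pE) s.2 = b at *
    have hu : (1 - a) * (1 - b) ≤ (1 - p * p) ^ (s.1 + s.2) := by
      rw [pow_add]; exact mul_le_mul hu1 hu2 (by linarith) (pow_nonneg (by nlinarith) _)
    have hn := hM (s.1 + s.2)
    push_cast at hn
    have h0 : (0 : ℝ) ≤ (s.1 : ℝ) + s.2 := by positivity
    have := mul_le_mul_of_nonneg_left hu h0
    nlinarith
  rw [IsPolicy.kernel_op, div_le_iff₀ (by positivity)]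
  nlinarith [mul_le_mul_of_nonneg_left (key Kind.H) hlH.le,
    mul_le_mul_of_nonneg_left (key Kind.E) hlE.le]

include hlH hlE in
theorem bilateral_existsUnique :
    ∃! π, IsSteadyState (rateMatrix lamH lamE (bilateralMatchH pH pE)) π := by
  have hpol := isPolicy_bilateral hH hH1 hE hE1
  obtain ⟨C, -, hC⟩ := bilateral_foster hH hH1 hE hE1 hlH hlE
  obtain ⟨π, hπ⟩ := FinKernel.exists_isStat (κ := hpol.kernel hlH hlE) (0, 0)
    (g := fun s => (s.1 : ℝ) + s.2)
    (fun s => by positivity) (fun s => by positivity) hC (finite_sublevel fun s => le_rfl)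
  refine ⟨π, (hpol.isSteadyState_iff hlH hlE π).2 hπ, fun π' h' => ?_⟩
  exact FinKernel.IsStat.unique (0, 0) (bilateral_reach hH hH1 hE hE1 hlH hlE)
    ((hpol.isSteadyState_iff hlH hlE π').1 h') hπ

theorem bilateral_summable {π : Market → ℝ}
    (hπ : ((isPolicy_bilateral hH hH1 hE hE1).kernel hlH hlE).IsStat π) :
    Summable fun s => π s * s.1 := by
  obtain ⟨C, hC0, hC⟩ := bilateral_foster hH hH1 hE hE1 hlH hlE
  have := (hπ.drift_bound (m := 0) (g := fun s => (s.1 : ℝ) + s.2) (fun s => by positivity)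
    (fun s => by positivity) hC0 hC).1
  refine Summable.of_nonneg_of_le (fun s => mul_nonneg (hπ.nonneg s) (by positivity))
    (fun s => mul_le_mul_of_nonneg_left ?_ (hπ.nonneg s)) this
  simp

end Bilateral

/-- The drift of (h - hs)² + A e² equals the ideal one, in which `H` arrivals always join, up to
bounded terms. The mean `H` displacement at an `H` arrival is 1 - (2a + b - ab), and the correction
hurts only for h < hs. There the part from a is bounded since hs and h are O(1/p) while a = O(p²h);
the part from b is O(e). The latter is absorbed by the decrease of A e² at those `E` arrivals that
find no `H` agent, which have probability 1 - c ≥ ρ. -/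
theorem bilateral_drift_algebra {lamH lamE p A Y ρ M hs h e a b c μ : ℝ} (hlH : 0 < lamH)
    (hlE : 0 < lamE) (hp : 0 < p) (hA0 : 0 < A) (hY0 : 0 < Y) (hρ0 : 0 < ρ) (hhs0 : 0 < hs)
    (hhsY : hs * p ≤ Y) (h0 : 0 ≤ h) (e0 : 0 ≤ e) (a0 : 0 ≤ a) (a1 : a ≤ 1) (b0 : 0 ≤ b)
    (b1 : b ≤ 1) (c0 : 0 ≤ c) (c1 : c ≤ 1) (hab : a ≤ p * (p * h)) (hbb : b ≤ p * e)
    (hMe : e * μ ≤ M) (hr : h < hs → ρ ≤ 1 - c) (hμ0 : 0 ≤ μ)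
    (hAρ : Y / ρ * lamH = A * lamE) :
    (lamH * (a * (h - 1 - hs) ^ 2 + a * (A * e ^ 2)
          + (1 - a) * (b * ((h - hs) ^ 2 + A * (e - 1) ^ 2))
          + (1 - a) * (1 - b) * ((h + 1 - hs) ^ 2 + A * e ^ 2))
        + lamE * (c * (h - 1 - hs) ^ 2 + c * (A * e ^ 2)
          + (1 - c) * ((1 - μ) * ((h - hs) ^ 2 + A * (e - 1) ^ 2))
          + (1 - c) * (1 - (1 - μ)) * ((h - hs) ^ 2 + A * (e + 1) ^ 2))) / (lamH + lamE) ≤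
      (h - hs) ^ 2 + A * e ^ 2 - 2 * (h - hs) * (lamE * c - lamH) / (lamH + lamE)
        + (lamH * (1 + A + 4 * Y ^ 2) + lamE * (1 + A + 4 * A * M)) / (lamH + lamE) := by
  have hl : 0 < lamH + lamE := by positivity
  have hη : -2 * (h - hs) * (2 * a + b - a * b) ≤ 4 * Y ^ 2 + 2 * (Y / ρ) * (e * (1 - c)) := by
    have hrhs : 0 ≤ 2 * (Y / ρ) * (e * (1 - c)) := by
      have : 0 ≤ 1 - c := by linarith
      positivity
    have hη0 : 0 ≤ 2 * a + b - a * b := by nlinarith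
    rcases le_or_gt hs h with hh | hh
    · have : 0 ≤ (h - hs) * (2 * a + b - a * b) := mul_nonneg (by linarith) hη0
      nlinarith [sq_nonneg Y]
    · have g1 : p * h ≤ Y := (mul_le_mul_of_nonneg_left hh.le hp.le).trans (by linarith)
      have g2 : hs * a ≤ Y * Y := by
        calc hs * a ≤ hs * (p * (p * h)) := by gcongr
          _ = (hs * p) * (p * h) := by ring
          _ ≤ Y * Y := by gcongr
      have g3 : hs * b ≤ Y / ρ * (e * (1 - c)) := by
        calc hs * b ≤ hs * (p * e) := by gcongr
          _ = (hs * p) * e := by ring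
          _ ≤ Y * e := by gcongr
          _ = Y / ρ * (e * ρ) := by field_simp
          _ ≤ Y / ρ * (e * (1 - c)) := by gcongr; exact hr hh
      have g4 : (hs - h) * (2 * a + b - a * b) ≤ hs * (2 * a + b) := by
        apply mul_le_mul (by linarith) (by nlinarith) hη0 hhs0.le
      nlinarith
  have h2 : a + (1 - a) * (1 - b) ≤ 1 := by nlinarith [mul_nonneg b0 (sub_nonneg.2 a1)]
  have h3 : (1 - a) * b * (A * (1 - 2 * e)) ≤ A := by
    have q0 : 0 ≤ (1 - a) * b := mul_nonneg (by linarith) b0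
    have q1 : (1 - a) * b ≤ 1 := mul_le_one₀ (by linarith) b0 b1
    calc (1 - a) * b * (A * (1 - 2 * e)) ≤ (1 - a) * b * A := by
          refine mul_le_mul_of_nonneg_left ?_ q0; nlinarith
      _ ≤ A := mul_le_of_le_one_left hA0.le q1
  -- An `E` agent without an `H` partner finds an `E` partner except with probability μ. As eμ ≤ M,
  -- the weighted square of e decreases linearly in e.
  have h4 : (1 - c) * (A * (1 + 2 * e * (2 * μ - 1))) ≤ A + A * (4 * M - 2 * (e * (1 - c))) := by
    have q0 : 0 ≤ 1 - c := by linarith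
    have q1 : (1 - c) * (e * μ) ≤ M := by
      calc (1 - c) * (e * μ) ≤ 1 * (e * μ) := by
            refine mul_le_mul_of_nonneg_right (by linarith) (by positivity)
        _ ≤ M := by linarith
    have q2 : (1 - c) * (1 + 2 * e * (2 * μ - 1)) ≤ 1 + (4 * M - 2 * (e * (1 - c))) := by
      nlinarith
    calc _ = A * ((1 - c) * (1 + 2 * e * (2 * μ - 1))) := by ring
      _ ≤ A * (1 + (4 * M - 2 * (e * (1 - c)))) := mul_le_mul_of_nonneg_left q2 hA0.le
      _ = _ := by ring
  rw [div_le_iff₀ hl]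
  have hR : ((h - hs) ^ 2 + A * e ^ 2 - 2 * (h - hs) * (lamE * c - lamH) / (lamH + lamE)
      + (lamH * (1 + A + 4 * Y ^ 2) + lamE * (1 + A + 4 * A * M)) / (lamH + lamE))
        * (lamH + lamE) = (lamH + lamE) * ((h - hs) ^ 2 + A * e ^ 2)
        - 2 * (h - hs) * (lamE * c - lamH)
        + (lamH * (1 + A + 4 * Y ^ 2) + lamE * (1 + A + 4 * A * M)) := by
    field_simp
  rw [hR]
  have k1 := mul_le_mul_of_nonneg_left (add_le_add (add_le_add hη h2) h3) hlH.le
  have k2 := mul_le_mul_of_nonneg_left (add_le_add h4 c1) hlE.le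
  have k3 : lamH * (2 * (Y / ρ) * (e * (1 - c))) = 2 * (A * lamE) * (e * (1 - c)) := by
    rw [← hAρ]; ring
  linarith

set_option maxHeartbeats 1000000 in
/-- The mean drift of the rescaled number of `H` agents under bilateral matching vanishes at order
`-log (1 - pE * pH)`. -/
theorem bilateral_mean_bound {lamH lamE pE : ℝ} (hlH : 0 < lamH) (hlt : lamH < lamE)
    (hE : 0 < pE) (hE1 : pE ≤ 1) :
    ∃ C : ℝ, 0 ≤ C ∧ ∀ (pH : ℝ) (hH : 0 < pH) (hH2 : pH ≤ 1 / 2) (π : Market → ℝ),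
      ((isPolicy_bilateral hH (hH2.trans (by norm_num)) hE hE1).kernel hlH
        (hlH.trans hlt)).IsStat π →
      let θ := -Real.log (1 - pE * pH)
      let y := -Real.log (1 - lamH / lamE)
      Summable (fun s : Market =>
        π s * ((θ * s.1 - y) * (lamE * (1 - Real.exp (-(θ * s.1))) - lamH))) ∧
      ∑' s : Market, π s * ((θ * s.1 - y) * (lamE * (1 - Real.exp (-(θ * s.1))) - lamH)) ≤ C * θ := by
  have hlE : 0 < lamE := hlH.trans hlt
  obtain ⟨M, hM0, hM⟩ := exists_mul_pow_le (μ := 1 - pE * pE) (by nlinarith) (by nlinarith)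
  set y := -Real.log (1 - lamH / lamE) with hy
  have hu0 : 0 < 1 - lamH / lamE := sub_pos.2 ((div_lt_one hlE).2 hlt)
  have hu1 : 1 - lamH / lamE < 1 := sub_lt_self _ (by positivity)
  have hy0 : 0 < y := neg_pos.2 (Real.log_neg hu0 hu1)
  set ρ := Real.exp (-y) with hρ
  have hρu : ρ = 1 - lamH / lamE := by rw [hρ, hy, neg_neg, Real.exp_log hu0]
  have hρ0 : 0 < ρ := Real.exp_pos _
  set Y := y / pE with hY
  have hY0 : 0 < Y := by positivity
  -- A is chosen so that A * lamE = (Y / ρ) * lamH: the gain from `E`-`E` matches exactly cancels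
  -- the loss from `H` arrivals matched with `E` agents.
  set A := Y * lamH / (ρ * lamE) with hA
  have hA0 : 0 < A := by positivity
  refine ⟨(lamH * (1 + A + 4 * Y ^ 2) + lamE * (1 + A + 4 * A * M)) / 2, by positivity, ?_⟩
  intro pH hH hH2 π hπ θ _
  have hH1 : pH ≤ 1 := hH2.trans (by norm_num)
  have hx0 : 0 < pE * pH := by positivity
  have hx1 : pE * pH < 1 := by nlinarith
  have hθx : pE * pH ≤ θ := by
    have := Real.log_le_sub_one_of_pos (x := 1 - pE * pH) (by linarith)
    show _ ≤ -_
    linarith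
  have hθ0 : 0 < θ := hx0.trans_le hθx
  have hpow : ∀ n : ℕ, (1 - pE * pH) ^ n = Real.exp (-(θ * n)) := fun n => by
    rw [show -(θ * n) = n * Real.log (1 - pE * pH) by simp only [θ]; ring, Real.exp_nat_mul,
      Real.exp_log (by linarith)]
  -- The balance point in unscaled units, where an `E` arrival misses all `H` agents with
  -- probability ρ.
  set hs := y / θ with hhs
  have hhs0 : 0 < hs := by positivity
  have hhsY : hs * pH ≤ Y := by
    rw [hhs, hY, div_mul_eq_mul_div, div_le_div_iff₀ hθ0 hE]
    nlinarith
  set φ : Market → ℝ := fun s => (θ * s.1 - y) * (lamE * (1 - Real.exp (-(θ * s.1))) - lamH)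
    with hφ
  have hm : lamE * (1 - ρ) = lamH := by rw [hρu]; field_simp; ring
  have hφ0 : ∀ s, 0 ≤ φ s := fun s => by
    rcases le_total (θ * s.1) y with h | h
    · have : ρ ≤ Real.exp (-(θ * s.1)) := Real.exp_le_exp.2 (by linarith)
      exact mul_nonneg_of_nonpos_of_nonpos (by linarith) (by nlinarith)
    · have : Real.exp (-(θ * s.1)) ≤ ρ := Real.exp_le_exp.2 (by linarith)
      exact mul_nonneg (by linarith) (by nlinarith)
  have hl : 0 < lamH + lamE := by positivity
  have hdrift : ∀ s, ((isPolicy_bilateral hH hH1 hE hE1).kernel hlH hlE).op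
      (fun s => ((s.1 : ℝ) - hs) ^ 2 + A * (s.2 : ℝ) ^ 2) s ≤
      (((s.1 : ℝ) - hs) ^ 2 + A * (s.2 : ℝ) ^ 2) - 2 / (θ * (lamH + lamE)) * φ s
        + (lamH * (1 + A + 4 * Y ^ 2) + lamE * (1 + A + 4 * A * M)) / (lamH + lamE) := by
    rintro ⟨h, e⟩
    rw [IsPolicy.kernel_op, sum_bilateral, sum_bilateral]
    simp only [acceptProb, join]
    have hfc : find (pE * pH) h = 1 - Real.exp (-(θ * h)) := by rw [find, hpow]
    have hφe : 2 / (θ * (lamH + lamE)) * φ (h, e) =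
        2 * (h - hs) * (lamE * find (pE * pH) h - lamH) / (lamH + lamE) := by
      rw [hfc, hφ, hhs]; field_simp
    rw [hφe]
    have e0 : (0 : ℝ) ≤ e := by positivity
    have h0 : (0 : ℝ) ≤ h := by positivity
    have t1 : ∀ q : ℝ, find q h * ((((h - 1 : ℕ) : ℝ) - hs) ^ 2 + A * (e : ℝ) ^ 2)
        = find q h * ((h : ℝ) - 1 - hs) ^ 2 + find q h * (A * (e : ℝ) ^ 2) := fun q => by
      rcases Nat.eq_zero_or_pos h with h' | h'
      · simp [h', find_zero]
      · rw [Nat.cast_sub h']; push_cast; ring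
    have t2 : ∀ q : ℝ, find q e * (((h : ℝ) - hs) ^ 2 + A * ((e - 1 : ℕ) : ℝ) ^ 2)
        = find q e * (((h : ℝ) - hs) ^ 2 + A * ((e : ℝ) - 1) ^ 2) := fun q => by
      rcases Nat.eq_zero_or_pos e with h' | h'
      · simp [h', find_zero]
      · rw [Nat.cast_sub h']; push_cast; ring
    have t2' : (1 - find (pH * pH) h) * find (pH * pE) e
        * (((h : ℝ) - hs) ^ 2 + A * ((e - 1 : ℕ) : ℝ) ^ 2) = (1 - find (pH * pH) h)
        * (find (pH * pE) e * (((h : ℝ) - hs) ^ 2 + A * ((e : ℝ) - 1) ^ 2)) := by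
      rw [mul_assoc, t2]
    have t2'' : (1 - find (pE * pH) h) * find (pE * pE) e
        * (((h : ℝ) - hs) ^ 2 + A * ((e - 1 : ℕ) : ℝ) ^ 2) = (1 - find (pE * pH) h)
        * (find (pE * pE) e * (((h : ℝ) - hs) ^ 2 + A * ((e : ℝ) - 1) ^ 2)) := by
      rw [mul_assoc, t2]
    rw [t1, t1, t2', t2'']
    push_cast
    obtain ⟨a0, a1⟩ := find_accept_mul_nonneg hH hH1 hE hE1 Kind.H hH hH1 h
    obtain ⟨b0, b1⟩ := find_accept_mul_nonneg hH hH1 hE hE1 Kind.H hE hE1 e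
    obtain ⟨c0, c1⟩ := find_accept_mul_nonneg hH hH1 hE hE1 Kind.E hH hH1 h
    have hab : find (pH * pH) h ≤ pH * (pH * h) := by
      rw [← mul_assoc]; exact find_le_mul (mul_le_one₀ hH1 hH.le hH1) h
    have hbb : find (pH * pE) e ≤ pH * e :=
      (find_le_mul (mul_le_one₀ hH1 hE.le hE1) e).trans
        (mul_le_mul_of_nonneg_right (mul_le_of_le_one_right hH.le hE1) e0)
    have hMe := hM e
    have hfm : find (pE * pE) e = 1 - (1 - pE * pE) ^ e := rfl
    rw [hfm]
    simp only [acceptProb] at a0 a1 b0 b1 c0 c1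
    have hr : (h : ℝ) < hs → ρ ≤ 1 - find (pE * pH) h := fun hlt' => by
      rw [hfc, sub_sub_cancel]
      refine Real.exp_le_exp.2 ?_
      rw [hhs, lt_div_iff₀ hθ0] at hlt'
      linarith
    have hμ0 : 0 ≤ (1 - pE * pE) ^ e := pow_nonneg (sub_nonneg.2 (mul_le_one₀ hE1 hE.le hE1)) e
    have hAρ : Y / ρ * lamH = A * lamE := by rw [hA]; field_simp
    exact bilateral_drift_algebra hlH hlE hH hA0 hY0 hρ0 hhs0 hhsY h0 e0 a0 a1 b0 b1 c0 c1 hab hbb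
      hMe hr hμ0 hAρ
  have hb := hπ.drift_bound (m := 0) (g := fun s => 2 / (θ * (lamH + lamE)) * φ s)
    (fun s => by positivity) (fun s => mul_nonneg (by positivity) (hφ0 s)) (by positivity) hdrift
  have hcomm : (fun s => π s * (2 / (θ * (lamH + lamE)) * φ s))
      = fun s => 2 / (θ * (lamH + lamE)) * (π s * φ s) := by funext s; ring
  rw [hcomm, tsum_mul_left, summable_mul_left_iff (by positivity)] at hb
  refine ⟨hb.1, ?_⟩
  have := hb.2
  rw [div_mul_eq_mul_div, div_le_div_iff₀ (by positivity) hl] at this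
  have h2 : 2 * (∑' s, π s * φ s) ≤
      (lamH * (1 + A + 4 * Y ^ 2) + lamE * (1 + A + 4 * A * M)) * θ := by
    refine le_of_mul_le_mul_right ?_ hl
    linarith
  show ∑' s, π s * φ s ≤ _
  linarith

/-! ### ChainMatch(d): the recursion along a chain-segment -/

theorem segmentEnd_eq (pH pE : ℝ) (h e : ℕ) (t : Market) :
    segmentEnd pH pE h e t = find pH h * segmentEnd pH pE (h - 1) e t
      + (1 - find pH h) * (find pE e * segmentEnd pH pE h (e - 1) t)
      + (1 - find pH h) * (1 - find pE e) * pt (h, e) t := by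
  rcases h with _ | h <;> rcases e with _ | e <;> rw [segmentEnd] <;>
    simp only [find_zero, Nat.add_sub_cancel] <;> ring

/-- Induction over the states that a chain-segment runs through. -/
theorem segment_induction {motive : ℕ → ℕ → Prop}
    (step : ∀ h e, (h ≠ 0 → motive (h - 1) e) → (e ≠ 0 → motive h (e - 1)) → motive h e)
    (h e : ℕ) : motive h e := by
  induction hn : h + e using Nat.strong_induction_on generalizing h e with
  | _ n ih =>
    exact step h e (fun h0 => ih _ (by omega) _ _ rfl) (fun e0 => ih _ (by omega) _ _ rfl)

theorem find_mul_le {p : ℝ} (h0 : 0 ≤ p) (h1 : p ≤ 1) {n : ℕ} {x y : ℝ} (h : n ≠ 0 → x ≤ y) :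
    find p n * x ≤ find p n * y := by
  rcases eq_or_ne n 0 with rfl | hn
  · simp [find_zero]
  · exact mul_le_mul_of_nonneg_left (h hn) (find_nonneg h0 h1 n)

theorem find_mul_congr {p : ℝ} {n : ℕ} {x y : ℝ} (h : n ≠ 0 → x = y) :
    find p n * x = find p n * y := by
  rcases eq_or_ne n 0 with rfl | hn
  · simp [find_zero]
  · rw [h hn]

section Chain

variable {pH pE : ℝ} (hH : 0 < pH) (hH1 : pH ≤ 1) (hE : 0 < pE) (hE1 : pE ≤ 1)

theorem segmentEnd_supp (pH pE : ℝ) (h e : ℕ) (t : Market) (ht : ¬(t.1 ≤ h ∧ t.2 ≤ e)) :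
    segmentEnd pH pE h e t = 0 := by
  induction h, e using segment_induction with
  | step h e ih1 ih2 =>
    have a : find pH h * segmentEnd pH pE (h - 1) e t = find pH h * 0 :=
      find_mul_congr fun h0 => ih1 h0 (by omega)
    have b : find pE e * segmentEnd pH pE h (e - 1) t = find pE e * 0 :=
      find_mul_congr fun h0 => ih2 h0 (by omega)
    have c : pt (h, e) t = 0 := if_neg fun h0 => ht (by subst h0; exact ⟨le_rfl, le_rfl⟩)
    rw [segmentEnd_eq, a, b, c]; ring

include hH hH1 hE hE1

theorem segmentEnd_nonneg (h e : ℕ) (t : Market) : 0 ≤ segmentEnd pH pE h e t := by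
  induction h, e using segment_induction with
  | step h e ih1 ih2 =>
    have a := find_mul_le hH.le hH1 ih1
    have b := find_mul_le hE.le hE1 ih2
    rw [mul_zero] at a b
    have c := sub_nonneg.2 (find_le_one hH1 h)
    have d := sub_nonneg.2 (find_le_one hE1 e)
    rw [segmentEnd_eq]
    exact add_nonneg (add_nonneg a (mul_nonneg c b)) (mul_nonneg (mul_nonneg c d) (pt_nonneg _ _))

theorem segmentEnd_zero_pos (h e : ℕ) : 0 < segmentEnd pH pE h e (0, 0) := by
  induction h, e using segment_induction with
  | step h e ih1 ih2 =>
    have n1 := segmentEnd_nonneg hH hH1 hE hE1 (h - 1) e (0, 0)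
    have n2 := segmentEnd_nonneg hH hH1 hE hE1 h (e - 1) (0, 0)
    have f1 := find_nonneg hH.le hH1 h
    have f2 := find_nonneg hE.le hE1 e
    have c := sub_nonneg.2 (find_le_one hH1 h)
    have d := sub_nonneg.2 (find_le_one hE1 e)
    rw [segmentEnd_eq]
    rcases eq_or_ne h 0 with rfl | h0
    · rcases eq_or_ne e 0 with rfl | e0
      · simp [find_zero, pt]
      · have := mul_pos (find_pos hE hE1 e0) (ih2 e0)
        simp only [find_zero]
        have := mul_nonneg d (pt_nonneg (0, e) (0, 0))
        linarith
    · have := mul_pos (find_pos hH hH1 h0) (ih1 h0)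
      exact add_pos_of_pos_of_nonneg (add_pos_of_pos_of_nonneg this
        (mul_nonneg c (mul_nonneg f2 n2))) (mul_nonneg (mul_nonneg c d) (pt_nonneg _ _))

/-- Comparison principle: a supersolution of the recursion bounds the mean over the final state of
a chain-segment. -/
theorem segment_mean_le {f : Market → ℝ} {U : ℕ → ℕ → ℝ}
    (hU : ∀ h e, find pH h * U (h - 1) e + (1 - find pH h) * (find pE e * U h (e - 1))
      + (1 - find pH h) * (1 - find pE e) * f (h, e) ≤ U h e) {A : Finset Market} (h e : ℕ)
    (hA : ∀ t : Market, t.1 ≤ h → t.2 ≤ e → t ∈ A) :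
    ∑ t ∈ A, segmentEnd pH pE h e t * f t ≤ U h e := by
  induction h, e using segment_induction with
  | step h e ih1 ih2 =>
    refine le_trans (le_of_eq ?_) ((add_le_add_left (add_le_add
      (find_mul_le hH.le hH1 fun h0 => ih1 h0 fun t a b => hA t (by omega) b)
      (mul_le_mul_of_nonneg_left
        (find_mul_le hE.le hE1 fun e0 => ih2 e0 fun t a b => hA t a (by omega))
        (sub_nonneg.2 (find_le_one hH1 h)))) _).trans (hU h e))
    rw [← sum_pt_mul (hA (h, e) le_rfl le_rfl) f, Finset.mul_sum, Finset.mul_sum, Finset.mul_sum,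
      Finset.mul_sum, ← Finset.sum_add_distrib, ← Finset.sum_add_distrib]
    exact Finset.sum_congr rfl fun t _ => by rw [segmentEnd_eq]; ring

omit hH hH1 hE hE1 in
theorem sum_chain (d : ℕ) (pH pE : ℝ) (k : Kind) (s : Market) (f : Market → ℝ) :
    ∑ t ∈ box s, chainMatch d pH pE k s t * f t =
      find (acceptProb pH pE k) d * ∑ t ∈ box s, segmentEnd pH pE s.1 s.2 t * f t
      + (1 - find (acceptProb pH pE k) d) * f (join k s) := by
  have h3 : join k s ∈ box s := mem_box.2 (by cases k <;> simp [join])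
  rw [← sum_pt_mul h3 f, Finset.mul_sum, Finset.mul_sum, ← Finset.sum_add_distrib]
  exact Finset.sum_congr rfl fun t _ => by simp only [chainMatch]; ring

variable {d : ℕ} (hd : 1 ≤ d)

theorem find_accept_nonneg (k : Kind) (n : ℕ) :
    0 ≤ find (acceptProb pH pE k) n ∧ find (acceptProb pH pE k) n ≤ 1 :=
  ⟨find_nonneg (acceptProb_pos hH hE k).le (acceptProb_le_one hH1 hE1 k) n,
    find_le_one (acceptProb_le_one hH1 hE1 k) n⟩

include hd

theorem isPolicy_chain : IsPolicy (chainMatch d pH pE) where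
  nonneg k s t := by
    obtain ⟨a0, a1⟩ := find_accept_nonneg hH hH1 hE hE1 k d
    exact add_nonneg (mul_nonneg a0 (segmentEnd_nonneg hH hH1 hE hE1 _ _ _))
      (mul_nonneg (sub_nonneg.2 a1) (pt_nonneg _ _))
  supp k s t ht := by
    rw [mem_box] at ht
    have h3 : pt (join k s) t = 0 := if_neg fun h => ht (by subst h; cases k <;> simp [join])
    rw [chainMatch, h3, segmentEnd_supp pH pE s.1 s.2 t (by omega)]; ring
  sum_one k s := by
    have := sum_chain d pH pE k s fun _ => 1
    simp only [mul_one] at this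
    rw [this]
    have hbox : ∀ t : Market, t.1 ≤ s.1 → t.2 ≤ s.2 → t ∈ box s := fun t a b =>
      mem_box.2 ⟨by omega, by omega⟩
    -- The constants 1 and -1 both solve the recursion, so comparison bounds the total mass from
    -- above and below by one.
    have h1 := segment_mean_le hH hH1 hE hE1 (f := fun _ => 1) (U := fun _ _ => 1)
      (fun h e => le_of_eq (by ring)) s.1 s.2 hbox
    have h2 := segment_mean_le hH hH1 hE hE1 (f := fun _ => -1) (U := fun _ _ => -1)
      (fun h e => le_of_eq (by ring)) s.1 s.2 hbox
    simp only [mul_one, mul_neg, Finset.sum_neg_distrib] at h1 h2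
    rw [le_antisymm h1 (by linarith)]; ring
  easy_le s t ht := by
    have h3 : pt (join Kind.E s) t = 0 := if_neg fun h => by subst h; simp [join] at ht
    rw [chainMatch, h3, segmentEnd_supp pH pE s.1 s.2 t (by omega)]; ring
  leave s hs := by
    refine ⟨Kind.H, (0, 0), ?_, hs⟩
    obtain ⟨a0, a1⟩ := find_accept_nonneg hH hH1 hE hE1 Kind.H d
    exact add_pos_of_pos_of_nonneg (mul_pos (find_pos hH hH1 (by omega))
      (segmentEnd_zero_pos hH hH1 hE hE1 _ _)) (mul_nonneg (sub_nonneg.2 a1) (pt_nonneg _ _))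

variable {lamH lamE : ℝ} (hlH : 0 < lamH) (hlE : 0 < lamE)

theorem chain_reach (s : Market) : Relation.ReflTransGen
    (fun s t => 0 < ((isPolicy_chain hH hH1 hE hE1 hd).kernel hlH hlE).P s t) s (0, 0) := by
  have hpol := isPolicy_chain hH hH1 hE hE1 hd
  refine Relation.ReflTransGen.single ?_
  rw [hpol.kernel_P]
  have a : 0 < chainMatch d pH pE Kind.H s (0, 0) :=
    add_pos_of_pos_of_nonneg (mul_pos (find_pos hH hH1 (by omega))
      (segmentEnd_zero_pos hH hH1 hE hE1 _ _))
      (mul_nonneg (sub_nonneg.2 (find_accept_nonneg hH hH1 hE hE1 Kind.H d).2) (pt_nonneg _ _))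
  have b := hpol.nonneg Kind.E s (0, 0)
  positivity

/-- Drift of a function under ChainMatch, given a bound `L` on the decrease of its mean along a
chain-segment. -/
theorem chain_op_le {f : Market → ℝ} {s : Market} {L : ℝ}
    (hL : ∑ t ∈ box s, segmentEnd pH pE s.1 s.2 t * f t ≤ f s - L) :
    (lamH + lamE) * ((isPolicy_chain hH hH1 hE hE1 hd).kernel hlH hlE).op f s ≤
      (lamH + lamE) * f s + lamH * (1 - find pH d) * (f (s.1 + 1, s.2) - f s)
        + lamE * (1 - find pE d) * (f (s.1, s.2 + 1) - f s)
        - (lamH * find pH d + lamE * find pE d) * L := by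
  rw [IsPolicy.kernel_op, sum_chain, sum_chain, mul_div_cancel₀ _ (by positivity)]
  obtain ⟨a0, -⟩ := find_accept_nonneg hH hH1 hE hE1 Kind.H d
  obtain ⟨b0, -⟩ := find_accept_nonneg hH hH1 hE hE1 Kind.E d
  simp only [acceptProb, join] at *
  have h1 := mul_le_mul_of_nonneg_left hL (mul_nonneg hlH.le a0)
  have h2 := mul_le_mul_of_nonneg_left hL (mul_nonneg hlE.le b0)
  linarith

end Chain

/-! ### Lyapunov functions for each coordinate under ChainMatch -/

/-- Partial sums. -/
noncomputable def psum (b : ℕ → ℝ) (n : ℕ) : ℝ := ∑ j ∈ Finset.range (n + 1), b j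

theorem psum_succ (b : ℕ → ℝ) (n : ℕ) : psum b (n + 1) = psum b n + b (n + 1) :=
  Finset.sum_range_succ _ _

theorem psum_pred (b : ℕ → ℝ) {n : ℕ} (hn : n ≠ 0) : psum b (n - 1) = psum b n - b n := by
  obtain ⟨n, rfl⟩ := Nat.exists_eq_succ_of_ne_zero hn
  rw [Nat.succ_eq_add_one, psum_succ, Nat.add_sub_cancel]; ring

theorem psum_nonneg {b : ℕ → ℝ} (hb : ∀ n, 0 ≤ b n) (n : ℕ) : 0 ≤ psum b n :=
  Finset.sum_nonneg fun _ _ => hb _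

/-- `W` bounds from below what a run of successful searches takes away from `psum b`. -/
structure IsRunLoss (p : ℝ) (b W : ℕ → ℝ) : Prop where
  nonneg : ∀ n, 0 ≤ W n
  le : ∀ n, W n ≤ find p n * (b n + W (n - 1))

section RunLoss

variable {pH pE : ℝ} (hH : 0 < pH) (hH1 : pH ≤ 1) (hE : 0 < pE) (hE1 : pE ≤ 1)

include hH hH1 hE hE1

/-- Only the initial run of `H` agents is counted. If it is interrupted by an `E` agent, later
losses are discarded, at no cost since W ≥ 0. -/
theorem segment_mean_psum_fst {b W : ℕ → ℝ} (hW : IsRunLoss pH b W) (s : Market) :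
    ∑ t ∈ box s, segmentEnd pH pE s.1 s.2 t * psum b t.1 ≤ psum b s.1 - W s.1 := by
  refine segment_mean_le hH hH1 hE hE1 (f := fun t => psum b t.1)
    (U := fun h _ => psum b h - W h) (fun h e => ?_) s.1 s.2
    fun t h1 h2 => mem_box.2 ⟨by omega, by omega⟩
  have h1 : find pH h * (psum b (h - 1) - W (h - 1)) = find pH h * (psum b h - b h - W (h - 1)) :=
    find_mul_congr fun h0 => by rw [psum_pred b h0]
  have h2 := hW.le h
  have h3 : 0 ≤ (1 - find pH h) * (find pE e * W h) :=
    mul_nonneg (sub_nonneg.2 (find_le_one hH1 h))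
      (mul_nonneg (find_nonneg hE.le hE1 e) (hW.nonneg h))
  dsimp only
  rw [h1]
  linarith

/-- The bound depends on e alone: a successful `H` search only postpones the search among the `E`
agents. -/
theorem segment_mean_psum_snd {b W : ℕ → ℝ} (hW : IsRunLoss pE b W) (s : Market) :
    ∑ t ∈ box s, segmentEnd pH pE s.1 s.2 t * psum b t.2 ≤ psum b s.2 - W s.2 := by
  refine segment_mean_le hH hH1 hE hE1 (f := fun t => psum b t.2)
    (U := fun _ e => psum b e - W e) (fun h e => ?_) s.1 s.2
    fun t h1 h2 => mem_box.2 ⟨by omega, by omega⟩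
  have h1 : find pE e * (psum b (e - 1) - W (e - 1)) = find pE e * (psum b e - b e - W (e - 1)) :=
    find_mul_congr fun h0 => by rw [psum_pred b h0]
  have h2 := mul_le_mul_of_nonneg_left (hW.le e) (sub_nonneg.2 (find_le_one hH1 h))
  dsimp only
  rw [h1]
  linarith

end RunLoss

/-- Failure becomes unlikely for large n, so a run takes away many consecutive squares, more than
any multiple C n² up to a constant. -/
theorem exists_isRunLoss_sq {p : ℝ} (h0 : 0 < p) (h1 : p ≤ 1) {C : ℝ} (hC : 0 ≤ C) :
    ∃ D : ℝ, 0 ≤ D ∧ IsRunLoss p (fun n => (n : ℝ) ^ 2)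
      (fun n => max 0 (C * (n : ℝ) ^ 2 - D)) := by
  have hlim : Tendsto (fun n : ℕ => (1 - p) ^ n) atTop (𝓝 0) :=
    tendsto_pow_atTop_nhds_zero_of_lt_one (by linarith) (by linarith)
  have hev : ∀ᶠ n : ℕ in atTop, (1 - p) ^ n * (2 * (1 + C)) ≤ 1 := by
    have := hlim.mul_const (2 * (1 + C))
    rw [zero_mul] at this
    exact this.eventually (ge_mem_nhds one_pos)
  obtain ⟨N, hN⟩ := eventually_atTop.1 hev
  -- Beyond N the failure probability is at most 1 / (2(1 + C)), costing at most n²/2. Beyond 4C the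
  -- loss 2Cn from passing from n to n - 1 is also at most n²/2.
  set n₀ : ℕ := N + ⌈4 * C⌉₊ with hn₀
  refine ⟨C * (n₀ : ℝ) ^ 2, by positivity, fun n => le_max_left _ _, fun n => ?_⟩
  have hf0 := find_nonneg h0.le h1 n
  refine max_le (mul_nonneg hf0 (add_nonneg (by positivity) (le_max_left _ _))) ?_
  rcases le_or_gt n n₀ with hn | hn
  · have : (n : ℝ) ^ 2 ≤ (n₀ : ℝ) ^ 2 := by gcongr
    refine le_trans (by nlinarith) (mul_nonneg hf0 (add_nonneg (by positivity) (le_max_left _ _)))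
  · have hr := hN n (by omega)
    have hr0 : 0 ≤ (1 - p) ^ n := pow_nonneg (by linarith) n
    have h4 : 4 * C ≤ n := (Nat.le_ceil _).trans (by exact_mod_cast (by omega))
    have hn1 : ((n - 1 : ℕ) : ℝ) = n - 1 := by rw [Nat.cast_sub (by omega)]; norm_num
    refine le_trans ?_ (mul_le_mul_of_nonneg_left (add_le_add_right (le_max_right _ _) _) hf0)
    rw [hn1, find]
    have hnn : (0 : ℝ) ≤ n := by positivity
    set D := C * (n₀ : ℝ) ^ 2
    have hD : 0 ≤ D := by positivity
    generalize (1 - p) ^ n = r at *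
    have e1 : r * ((n : ℝ) ^ 2 + C * ((n : ℝ) - 1) ^ 2) ≤ (n : ℝ) ^ 2 / 2 := by
      have hnp : (1 : ℝ) ≤ n := by exact_mod_cast (by omega : 1 ≤ n)
      have : (n : ℝ) ^ 2 + C * ((n : ℝ) - 1) ^ 2 ≤ (1 + C) * (n : ℝ) ^ 2 := by nlinarith
      have := mul_le_mul_of_nonneg_left this hr0
      nlinarith [sq_nonneg (n : ℝ)]
    have e2 : 4 * C * n ≤ (n : ℝ) ^ 2 := by nlinarith
    nlinarith [mul_nonneg hr0 hD]

theorem sq_le_psum_sq (n : ℕ) : (n : ℝ) ^ 2 ≤ psum (fun n => (n : ℝ) ^ 2) n :=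
  Finset.single_le_sum (f := fun n : ℕ => (n : ℝ) ^ 2) (fun _ _ => by positivity)
    (Finset.self_mem_range_succ n)

/-- Drift of the number of waiting `E` agents, uniformly in `pH`. -/
theorem chain_drift_snd {pE : ℝ} (hE : 0 < pE) (hE1 : pE ≤ 1) {d : ℕ} (hd : 1 ≤ d)
    {lamH lamE : ℝ} (hlH : 0 < lamH) (hlE : 0 < lamE) :
    ∃ C : ℝ, 0 ≤ C ∧ ∀ (pH : ℝ) (hH : 0 < pH) (hH1 : pH ≤ 1) (s : Market),
      ((isPolicy_chain hH hH1 hE hE1 hd).kernel hlH hlE).op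
        (fun s => psum (fun n => (n : ℝ) ^ 2) s.2) s ≤
        psum (fun n => (n : ℝ) ^ 2) s.2 - (s.2 : ℝ) ^ 2 + C := by
  have hq := find_pos hE hE1 (n := d) (by omega)
  have hq1 := find_le_one hE1 d
  have hl : 0 < lamH + lamE := by positivity
  -- Of the three multiples of e², two pay for an arrival, as (e + 1)² ≤ 2e² + 2, and one is the
  -- drift. Only segments started by `E` agents are used, so no constant depends on pH.
  obtain ⟨D, hD0, hW⟩ := exists_isRunLoss_sq hE hE1
    (C := 3 * (lamH + lamE) / (lamE * find pE d)) (by positivity)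
  refine ⟨2 + lamE * find pE d * D / (lamH + lamE), by positivity, fun pH hH hH1 s => ?_⟩
  have h := chain_op_le hH hH1 hE hE1 hd hlH hlE (s := s)
    (f := fun s => psum (fun n => (n : ℝ) ^ 2) s.2) (segment_mean_psum_snd hH hH1 hE hE1 hW s)
  dsimp only at h
  rw [psum_succ] at h
  push_cast at h
  have hL0 := le_max_left 0 (3 * (lamH + lamE) / (lamE * find pE d) * (s.2 : ℝ) ^ 2 - D)
  have hL1 := le_max_right 0 (3 * (lamH + lamE) / (lamE * find pE d) * (s.2 : ℝ) ^ 2 - D)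
  generalize max 0 (3 * (lamH + lamE) / (lamE * find pE d) * (s.2 : ℝ) ^ 2 - D) = L at *
  have k1 := mul_le_mul_of_nonneg_left hL1 (mul_nonneg hlE.le hq.le)
  have k2 : lamE * find pE d * (3 * (lamH + lamE) / (lamE * find pE d) * (s.2 : ℝ) ^ 2 - D)
      = 3 * (lamH + lamE) * (s.2 : ℝ) ^ 2 - lamE * find pE d * D := by field_simp
  have k3 : 0 ≤ lamH * find pH d * L := mul_nonneg (mul_nonneg hlH.le (find_nonneg hH.le hH1 d)) hL0
  have k4 : lamE * (1 - find pE d) * ((s.2 : ℝ) + 1) ^ 2 ≤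
      (lamH + lamE) * (2 * (s.2 : ℝ) ^ 2 + 2) := by
    have : ((s.2 : ℝ) + 1) ^ 2 ≤ 2 * (s.2 : ℝ) ^ 2 + 2 := by nlinarith [sq_nonneg ((s.2 : ℝ) - 1)]
    refine mul_le_mul ?_ this (by positivity) hl.le
    nlinarith
  rw [← mul_le_mul_iff_right₀ hl]
  have k5 : (lamH + lamE) * (psum (fun n => (n : ℝ) ^ 2) s.2 - (s.2 : ℝ) ^ 2
      + (2 + lamE * find pE d * D / (lamH + lamE))) = (lamH + lamE) *
      (psum (fun n => (n : ℝ) ^ 2) s.2 - (s.2 : ℝ) ^ 2 + 2) + lamE * find pE d * D := by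
    field_simp; ring
  rw [k5]
  linarith

section Chain

variable {pH pE : ℝ} (hH : 0 < pH) (hH1 : pH ≤ 1) (hE : 0 < pE) (hE1 : pE ≤ 1)
  {d : ℕ} (hd : 1 ≤ d) {lamH lamE : ℝ} (hlH : 0 < lamH) (hlE : 0 < lamE)

theorem chain_drift_fst : ∃ C : ℝ, 0 ≤ C ∧ ∀ s : Market,
      ((isPolicy_chain hH hH1 hE hE1 hd).kernel hlH hlE).op
        (fun s => psum (fun n => (n : ℝ) ^ 2) s.1) s ≤
        psum (fun n => (n : ℝ) ^ 2) s.1 - (s.1 : ℝ) ^ 2 + C := by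
  have hq := find_pos hE hE1 (n := d) (by omega)
  have hq0 := find_nonneg hH.le hH1 d
  have hl : 0 < lamH + lamE := by positivity
  obtain ⟨D, hD0, hW⟩ := exists_isRunLoss_sq hH hH1
    (C := 3 * (lamH + lamE) / (lamE * find pE d)) (by positivity)
  refine ⟨2 + lamE * find pE d * D / (lamH + lamE), by positivity, fun s => ?_⟩
  have h := chain_op_le hH hH1 hE hE1 hd hlH hlE (s := s)
    (f := fun s => psum (fun n => (n : ℝ) ^ 2) s.1) (segment_mean_psum_fst hH hH1 hE hE1 hW s)
  dsimp only at h
  rw [psum_succ] at h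
  push_cast at h
  have hL0 := le_max_left 0 (3 * (lamH + lamE) / (lamE * find pE d) * (s.1 : ℝ) ^ 2 - D)
  have hL1 := le_max_right 0 (3 * (lamH + lamE) / (lamE * find pE d) * (s.1 : ℝ) ^ 2 - D)
  generalize max 0 (3 * (lamH + lamE) / (lamE * find pE d) * (s.1 : ℝ) ^ 2 - D) = L at *
  have k1 := mul_le_mul_of_nonneg_left hL1 (mul_nonneg hlE.le hq.le)
  have k2 : lamE * find pE d * (3 * (lamH + lamE) / (lamE * find pE d) * (s.1 : ℝ) ^ 2 - D)
      = 3 * (lamH + lamE) * (s.1 : ℝ) ^ 2 - lamE * find pE d * D := by field_simp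
  have k3 : 0 ≤ lamH * find pH d * L := mul_nonneg (mul_nonneg hlH.le hq0) hL0
  have k4 : lamH * (1 - find pH d) * ((s.1 : ℝ) + 1) ^ 2 ≤
      (lamH + lamE) * (2 * (s.1 : ℝ) ^ 2 + 2) := by
    have : ((s.1 : ℝ) + 1) ^ 2 ≤ 2 * (s.1 : ℝ) ^ 2 + 2 := by nlinarith [sq_nonneg ((s.1 : ℝ) - 1)]
    refine mul_le_mul ?_ this (by positivity) hl.le
    nlinarith
  rw [← mul_le_mul_iff_right₀ hl]
  have k5 : (lamH + lamE) * (psum (fun n => (n : ℝ) ^ 2) s.1 - (s.1 : ℝ) ^ 2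
      + (2 + lamE * find pE d * D / (lamH + lamE))) = (lamH + lamE) *
      (psum (fun n => (n : ℝ) ^ 2) s.1 - (s.1 : ℝ) ^ 2 + 2) + lamE * find pE d * D := by
    field_simp; ring
  rw [k5]
  linarith

include hlH hlE in
theorem chain_existsUnique (hH : 0 < pH) (hH1 : pH ≤ 1) (hE : 0 < pE) (hE1 : pE ≤ 1)
    (hd : 1 ≤ d) :
    ∃! π, IsSteadyState (rateMatrix lamH lamE (chainMatch d pH pE)) π := by
  have hpol := isPolicy_chain hH hH1 hE hE1 hd
  obtain ⟨C₁, -, h₁⟩ := chain_drift_fst hH hH1 hE hE1 hd hlH hlE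
  obtain ⟨C₂, -, h₂⟩ := chain_drift_snd hE hE1 hd hlH hlE
  have hsq : ∀ n : ℕ, (n : ℝ) ≤ (n : ℝ) ^ 2 := fun n => by
    exact_mod_cast Nat.le_self_pow two_ne_zero n
  obtain ⟨π, hπ⟩ := FinKernel.exists_isStat (κ := hpol.kernel hlH hlE) (0, 0)
    (f := (fun s => psum (fun n => (n : ℝ) ^ 2) s.1) + fun s => psum (fun n => (n : ℝ) ^ 2) s.2)
    (g := fun s => (s.1 : ℝ) ^ 2 + (s.2 : ℝ) ^ 2) (C := C₁ + C₂)
    (fun s => add_nonneg (psum_nonneg (fun _ => sq_nonneg _) _)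
      (psum_nonneg (fun _ => sq_nonneg _) _))
    (fun s => by positivity) (fun s => by
      rw [map_add, Pi.add_apply, Pi.add_apply]
      have := h₁ s
      have := h₂ pH hH hH1 s
      linarith)
    (finite_sublevel fun s => add_le_add (hsq _) (hsq _))
  refine ⟨π, (hpol.isSteadyState_iff hlH hlE π).2 hπ, fun π' h' => ?_⟩
  exact FinKernel.IsStat.unique (0, 0) (chain_reach hH hH1 hE hE1 hd hlH hlE)
    ((hpol.isSteadyState_iff hlH hlE π').1 h') hπ

theorem chain_summable {π : Market → ℝ}
    (hπ : ((isPolicy_chain hH hH1 hE hE1 hd).kernel hlH hlE).IsStat π) :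
    Summable fun s => π s * s.1 := by
  obtain ⟨C, hC0, hC⟩ := chain_drift_fst hH hH1 hE hE1 hd hlH hlE
  have := (hπ.drift_bound (m := 0) (g := fun s => (s.1 : ℝ) ^ 2)
    (fun s => psum_nonneg (fun _ => sq_nonneg _) _) (fun s => by positivity) hC0 hC).1
  refine Summable.of_nonneg_of_le (fun s => mul_nonneg (hπ.nonneg s) (by positivity))
    (fun s => mul_le_mul_of_nonneg_left ?_ (hπ.nonneg s)) this
  exact_mod_cast Nat.le_self_pow two_ne_zero s.1

end Chain

/-! ### Exponential scaling and the tail under ChainMatch -/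

/-- The exponential rate that belongs to a success probability. -/
noncomputable def rate (p : ℝ) : ℝ := -Real.log (1 - p)

theorem le_rate {p : ℝ} (h1 : p < 1) : p ≤ rate p := by
  have := Real.log_le_sub_one_of_pos (x := 1 - p) (by linarith)
  unfold rate; linarith

theorem find_eq_exp {p : ℝ} (h1 : p < 1) (n : ℕ) : find p n = 1 - Real.exp (-(rate p * n)) := by
  rw [find, show -(rate p * n) = n * Real.log (1 - p) by simp only [rate]; ring, Real.exp_nat_mul,
      Real.exp_log (by linarith)]

theorem rate_le_one {p : ℝ} (h1 : p ≤ 1 / 2) : rate p ≤ 1 := by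
  have h2 : Real.log (1 / 2) ≤ Real.log (1 - p) := Real.log_le_log (by norm_num) (by linarith)
  rw [one_div, Real.log_inv] at h2
  have := Real.log_two_lt_d9
  unfold rate; linarith

/-- Above level K the failure probability is at most 1 / (2(C + 1)), so with b the tail value at n,
failures cost at most b/2. This leaves b/2 to pay for the decrease Cθ of C b in one step, once b >
2Cθ; below that the claimed loss is zero. -/
theorem isRunLoss_linear {p K C : ℝ} (h0 : 0 < p) (h1 : p < 1) (hC : 0 ≤ C)
    (hK : Real.exp (-K) * (2 * (C + 1)) ≤ 1) :
    IsRunLoss p (fun n => max 0 (rate p * n - K))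
      (fun n => max 0 (C * max 0 (rate p * n - K) - 2 * C ^ 2 * rate p)) := by
  have hθ : 0 < rate p := h0.trans_le (le_rate h1)
  refine ⟨fun n => le_max_left _ _, fun n => ?_⟩
  have hf0 := find_nonneg h0.le h1.le n
  have hrhs : 0 ≤ find p n * (max 0 (rate p * n - K) +
      max 0 (C * max 0 (rate p * (n - 1 : ℕ) - K) - 2 * C ^ 2 * rate p)) :=
    mul_nonneg hf0 (add_nonneg (le_max_left _ _) (le_max_left _ _))
  refine max_le hrhs ?_
  rcases le_or_gt (max 0 (rate p * n - K)) (2 * C * rate p) with hb | hb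
  · refine le_trans ?_ hrhs
    nlinarith [mul_le_mul_of_nonneg_left hb hC]
  · have hpos : 0 < max 0 (rate p * n - K) := lt_of_le_of_lt (by positivity) hb
    have hbn : max 0 (rate p * n - K) = rate p * n - K :=
      max_eq_right (le_of_lt (by simpa using hpos))
    have hn : rate p * n - K ≤ rate p * ((n - 1 : ℕ) : ℝ) - K + rate p := by
      have : (n : ℝ) ≤ ((n - 1 : ℕ) : ℝ) + 1 := by exact_mod_cast (by omega : n ≤ n - 1 + 1)
      nlinarith
    refine le_trans ?_ (mul_le_mul_of_nonneg_left (add_le_add_right ((sub_le_sub_right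
      (mul_le_mul_of_nonneg_left (le_max_right _ _) hC) _).trans (le_max_right _ _)) _) hf0)
    rw [hbn] at hb hpos ⊢
    have hr : Real.exp (-(rate p * n)) * (2 * (C + 1)) ≤ 1 :=
      (mul_le_mul_of_nonneg_right (Real.exp_le_exp.2 (by linarith)) (by positivity)).trans hK
    have hr0 := Real.exp_pos (-(rate p * n))
    have hnC := mul_le_mul_of_nonneg_left hn hC
    rw [find_eq_exp h1] at hf0 ⊢
    generalize Real.exp (-(rate p * n)) = r at *
    generalize rate p * n - K = b at *
    generalize rate p * ((n - 1 : ℕ) : ℝ) - K = b' at *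
    have k1 : (1 - r) * (b + (C * b - C * rate p - 2 * C ^ 2 * rate p)) ≤
        (1 - r) * (b + (C * b' - 2 * C ^ 2 * rate p)) :=
      mul_le_mul_of_nonneg_left (by linarith) hf0
    refine le_trans ?_ k1
    have k2 := mul_le_mul_of_nonneg_right hr hpos.le
    have k3 : 0 ≤ r * (C * rate p + 2 * C ^ 2 * rate p) := by positivity
    nlinarith

/-- The mean of the far tail of the rescaled number of `H` agents is of order `rate pH`. -/
theorem chain_tail_bound {pE : ℝ} (hE : 0 < pE) (hE1 : pE ≤ 1) {d : ℕ} (hd : 1 ≤ d)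
    {lamH lamE : ℝ} (hlH : 0 < lamH) (hlE : 0 < lamE) :
    ∃ K C : ℝ, 0 ≤ K ∧ 0 ≤ C ∧ ∀ (pH : ℝ) (hH : 0 < pH) (hH1 : pH < 1) (π : Market → ℝ),
      ((isPolicy_chain hH hH1.le hE hE1 hd).kernel hlH hlE).IsStat π →
      Summable (fun s : Market => π s * max 0 (rate pH * s.1 - K)) ∧
      ∑' s : Market, π s * max 0 (rate pH * s.1 - K) ≤ C * rate pH := by
  have hq := find_pos hE hE1 (n := d) (by omega)
  have hl : 0 < lamH + lamE := by positivity
  set Q := lamE * find pE d with hQ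
  have hQ0 : 0 < Q := by positivity
  -- At rate Q, the loss c b pays lamH b for arriving `H` agents and leaves (lamH + lamE) b for the
  -- drift.
  set c := (lamH + (lamH + lamE)) / Q with hc
  have hc0 : 0 < c := by positivity
  refine ⟨Real.log (2 * (c + 1)), (lamH + Q * (2 * c ^ 2)) / (lamH + lamE),
    Real.log_nonneg (by linarith), by positivity, fun pH hH hH1 π hπ => ?_⟩
  set K := Real.log (2 * (c + 1)) with hK
  have hθ : 0 < rate pH := hH.trans_le (le_rate hH1)
  have hW := isRunLoss_linear (K := K) hH hH1 hc0.le (by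
    rw [hK, Real.exp_neg, Real.exp_log (by positivity), inv_mul_cancel₀ (by positivity)])
  have hb : ∀ n : ℕ, 0 ≤ max 0 (rate pH * n - K) := fun n => le_max_left _ _
  refine hπ.drift_bound (m := 0) (f := fun s => psum (fun n => max 0 (rate pH * n - K)) s.1)
    (fun s => psum_nonneg hb _) (fun s => hb _) (by positivity) fun s => ?_
  have h := chain_op_le hH hH1.le hE hE1 hd hlH hlE (s := s)
    (f := fun s => psum (fun n => max 0 (rate pH * n - K)) s.1)
    (segment_mean_psum_fst hH hH1.le hE hE1 hW s)
  dsimp only at h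
  rw [psum_succ] at h
  have hL0 := le_max_left 0 (c * max 0 (rate pH * s.1 - K) - 2 * c ^ 2 * rate pH)
  have hL1 := le_max_right 0 (c * max 0 (rate pH * s.1 - K) - 2 * c ^ 2 * rate pH)
  have hstep : max 0 (rate pH * (s.1 + 1 : ℕ) - K) ≤ max 0 (rate pH * s.1 - K) + rate pH := by
    push_cast
    refine max_le (add_nonneg (hb _) hθ.le) ?_
    linarith [le_max_right 0 (rate pH * s.1 - K)]
  have hbs := hb s.1
  have hbs' := hb (s.1 + 1)
  generalize max 0 (c * max 0 (rate pH * s.1 - K) - 2 * c ^ 2 * rate pH) = L at *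
  generalize max 0 (rate pH * s.1 - K) = b at *
  generalize max 0 (rate pH * (s.1 + 1 : ℕ) - K) = b' at *
  generalize psum (fun n => max 0 (rate pH * n - K)) s.1 = F at *
  have k1 := mul_le_mul_of_nonneg_left hL1 hQ0.le
  have k2 : Q * (c * b - 2 * c ^ 2 * rate pH) = (lamH + (lamH + lamE)) * b
      - Q * (2 * c ^ 2) * rate pH := by rw [hc]; field_simp
  have k3 : 0 ≤ lamH * find pH d * L :=
    mul_nonneg (mul_nonneg hlH.le (find_nonneg hH.le hH1.le d)) hL0
  have k4 : lamH * (1 - find pH d) * b' ≤ lamH * (b + rate pH) := by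
    refine mul_le_mul ?_ hstep hbs' hlH.le
    nlinarith [find_nonneg hH.le hH1.le d]
  rw [← mul_le_mul_iff_right₀ hl]
  have k5 : (lamH + lamE) * (F - b + (lamH + Q * (2 * c ^ 2)) / (lamH + lamE) * rate pH)
      = (lamH + lamE) * (F - b) + (lamH + Q * (2 * c ^ 2)) * rate pH := by field_simp
  rw [k5]
  linarith

/-! ### The compensated drift under ChainMatch -/

/-- The chain-segment estimate behind the second-order drift: `β` compensates the `E` agents, `b`
the `H` agents. -/
theorem segment_mean_compensated {pH pE : ℝ} (hH : 0 < pH) (hH1 : pH ≤ 1) (hE : 0 < pE)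
    (hE1 : pE ≤ 1) {b β : ℕ → ℝ} {B : ℝ} (hB : 0 ≤ B)
    (hb : ∀ n, n ≠ 0 → find pH n * b n = (1 - find pH n) * β n) (hβ0 : β 0 ≤ 0)
    (hβ : ∀ n, n ≠ 0 → find pH n * (β n - β (n - 1)) ≤ (1 - find pH n) * B) (s : Market) :
    ∑ t ∈ box s, segmentEnd pH pE s.1 s.2 t * (psum b t.1 - t.2 * β t.1) ≤
      (psum b s.1 - s.2 * β s.1) - (β s.1 - B * (1 + s.2) ^ 2) := by
  refine segment_mean_le hH hH1 hE hE1 (f := fun t => psum b t.1 - t.2 * β t.1)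
    (U := fun h e => (psum b h - e * β h) - (β h - B * (1 + e) ^ 2)) (fun h e => ?_) s.1 s.2
    fun t h1 h2 => mem_box.2 ⟨by omega, by omega⟩
  have he : find pE e * ((psum b h - (e - 1 : ℕ) * β h) - (β h - B * (1 + (e - 1 : ℕ)) ^ 2))
      = find pE e * (psum b h - e * β h + B * (e : ℝ) ^ 2) := find_mul_congr fun e0 => by
    rw [Nat.cast_sub (by omega)]; push_cast; ring
  -- When the `H` search fails, both ways to go on give `psum b h` - e β, up to B e²: an appended
  -- `E` agent lowers the count e, but brings a further run worth β. With x the success probability,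
  -- x b = (1 - x) β balances the rest; the variation of β costs (1 - x) B (1 + e), and e² + (1 + e)
  -- ≤ (1 + e)².
  dsimp only
  rw [he]
  have hr0 := sub_nonneg.2 (find_le_one hH1 h)
  have hf0 := find_nonneg hH.le hH1 h
  have g0 := find_nonneg hE.le hE1 e
  have g1 := find_le_one hE1 e
  have e0 : (0 : ℝ) ≤ e := by positivity
  have hsmall : find pE e * (B * (e : ℝ) ^ 2) ≤ B * (e : ℝ) ^ 2 :=
    mul_le_of_le_one_left (by positivity) g1
  have hsm := mul_le_mul_of_nonneg_left hsmall hr0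
  rcases eq_or_ne h 0 with rfl | h0
  · simp only [find_zero] at *
    nlinarith [mul_nonneg hB e0]
  · rw [psum_pred b h0]
    have hb' := hb h h0
    have hβ' := mul_le_mul_of_nonneg_right (hβ h h0) (by linarith : 0 ≤ 1 + (e : ℝ))
    generalize find pH h = x at *
    have hBe : 0 ≤ (1 - x) * (B * e) := by positivity
    linarith

theorem exp_sub_one_pos {x : ℝ} (hx : 0 < x) : 0 < Real.exp x - 1 := by
  have := Real.add_one_lt_exp hx.ne'
  linarith

/-- The truncated deviation of the rescaled number of `H` agents from `y`. -/
noncomputable def dev (y θ : ℝ) (n : ℕ) : ℝ := min (θ * n - y) 1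

/-- The solution b of the balance equation is β / (exp(θn) - 1), as the success odds are exp(θn) -
1. The last bound is the reason for truncating: β is flat once θ(n - 1) ≥ y + 1, and before that
failure has probability at least exp(-(y + 2)), so that an increment θ is affordable. -/
theorem chain_compensator {pH y : ℝ} (hH : 0 < pH) (hH2 : pH ≤ 1 / 2) (hy : 0 < y) :
    (∀ n : ℕ, n ≠ 0 → find pH n * (dev y (rate pH) n / (Real.exp (rate pH * n) - 1)) =
      (1 - find pH n) * dev y (rate pH) n) ∧ dev y (rate pH) 0 ≤ 0 ∧
    (∀ n : ℕ, n ≠ 0 → find pH n * (dev y (rate pH) n - dev y (rate pH) (n - 1)) ≤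
      (1 - find pH n) * (rate pH * Real.exp (y + 2))) := by
  have hθ : 0 < rate pH := hH.trans_le (le_rate (by linarith))
  have hθ1 := rate_le_one hH2
  have hf : ∀ n : ℕ, find pH n = 1 - Real.exp (-(rate pH * n)) := find_eq_exp (by linarith)
  set θ := rate pH
  refine ⟨fun n hn => ?_, ?_, fun n hn => ?_⟩
  · have hn' : 0 < θ * n := mul_pos hθ (by exact_mod_cast Nat.pos_of_ne_zero hn)
    have h1 := exp_sub_one_pos hn'
    rw [hf, Real.exp_neg]
    have h2 := Real.exp_pos (θ * n)
    field_simp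
    ring
  · simp only [dev]; exact (min_le_left _ _).trans (by simp [hy.le])
  · have hcast : ((n - 1 : ℕ) : ℝ) = n - 1 := by rw [Nat.cast_sub (by omega)]; norm_num
    have hr0 := Real.exp_pos (-(θ * n))
    have hf0 : 0 ≤ find pH n := find_nonneg hH.le (by linarith) n
    have hf1 : find pH n ≤ 1 := find_le_one (by linarith) n
    rcases le_or_gt (y + 1) (θ * (n - 1)) with hh | hh
    · have h1 : dev y θ n ≤ 1 := min_le_right _ _
      have h2 : dev y θ (n - 1) = 1 := by rw [dev, hcast]; exact min_eq_right (by linarith)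
      rw [h2]
      have : find pH n * (dev y θ n - 1) ≤ 0 := mul_nonpos_of_nonneg_of_nonpos hf0 (by linarith)
      refine this.trans (mul_nonneg (by linarith) (by positivity))
    · have h1 : dev y θ n - dev y θ (n - 1) ≤ θ := by
        rw [sub_le_iff_le_add, dev, dev, hcast, ← min_add_add_left]
        refine min_le_min (by linarith) (by linarith)
      have h2 : θ ≤ (1 - find pH n) * (θ * Real.exp (y + 2)) := by
        rw [hf, sub_sub_cancel, mul_left_comm, ← Real.exp_add]
        refine le_mul_of_one_le_right hθ.le (Real.one_le_exp ?_)
        linarith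
      exact (mul_le_mul_of_nonneg_left h1 hf0).trans
        ((mul_le_of_le_one_left hθ.le hf1).trans h2)

theorem psum_bddBelow {b : ℕ → ℝ} {N : ℕ} (hb : ∀ n, N ≤ n → 0 ≤ b n) (n : ℕ) :
    -∑ j ∈ Finset.range N, |b j| ≤ psum b n := by
  have h1 : ∀ j, -(if j < N then |b j| else 0) ≤ b j := fun j => by
    split_ifs with h
    · exact neg_abs_le _
    · simpa using hb j (not_lt.1 h)
  refine le_trans ?_ (Finset.sum_le_sum fun j (_ : j ∈ Finset.range (n + 1)) => h1 j)
  rw [Finset.sum_neg_distrib, neg_le_neg_iff, ← Finset.sum_filter]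
  refine Finset.sum_le_sum_of_subset_of_nonneg (fun j hj => ?_) fun _ _ _ => abs_nonneg _
  exact Finset.mem_range.2 (Finset.mem_filter.1 hj).2

/-- The drift of the rescaled number of `H` agents under ChainMatch. -/
noncomputable def chainDrift (lamH lamE x : ℝ) : ℝ := lamE - lamH / (Real.exp x - 1)

theorem chainDrift_strictMonoOn {lamH : ℝ} (lamE : ℝ) (hlH : 0 < lamH) :
    StrictMonoOn (chainDrift lamH lamE) (Set.Ioi 0) := fun _ hx _ _ hxy =>
  sub_lt_sub_left (div_lt_div_of_pos_left hlH (exp_sub_one_pos hx)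
    (sub_lt_sub_right (Real.exp_lt_exp.2 hxy) 1)) lamE

theorem chainDrift_log {lamH lamE : ℝ} (hlH : 0 < lamH) (hlE : 0 < lamE) :
    chainDrift lamH lamE (Real.log (1 + lamH / lamE)) = 0 := by
  have h : lamH / (lamH / lamE) = lamE := by field_simp
  rw [chainDrift, Real.exp_log (by positivity), add_sub_cancel_left, h, sub_self]

set_option maxHeartbeats 1000000 in
/-- The mean drift of the rescaled number of `H` agents under ChainMatch, weighted by its truncated
deviation from the balance point, is of order `rate pH`. -/
theorem chain_mean_bound {pE : ℝ} (hE : 0 < pE) (hE1 : pE ≤ 1) {d : ℕ} (hd : 1 ≤ d)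
    {lamH lamE : ℝ} (hlH : 0 < lamH) (hlE : 0 < lamE) :
    ∃ C : ℝ, 0 ≤ C ∧ ∀ (pH : ℝ) (hH : 0 < pH) (hH2 : pH ≤ 1 / 2) (_ : d * pH ≤ 1 / 2)
      (π : Market → ℝ),
      ((isPolicy_chain hH (hH2.trans (by norm_num)) hE hE1 hd).kernel hlH hlE).IsStat π →
      let g : Market → ℝ := fun s => dev (Real.log (1 + lamH / lamE)) (rate pH) (s.1 + 1) *
        chainDrift lamH lamE (rate pH * (s.1 + 1 : ℕ))
      (∀ s, 0 ≤ g s) ∧ Summable (fun s => π s * g s) ∧ ∑' s, π s * g s ≤ C * rate pH := by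
  obtain ⟨CE, hCE0, hCE⟩ := chain_drift_snd hE hE1 hd hlH hlE
  have hl : 0 < lamH + lamE := by positivity
  set y := Real.log (1 + lamH / lamE) with hy
  have hy0 : 0 < y := Real.log_pos (by have : 0 < lamH / lamE := by positivity
                                       linarith)
  refine ⟨2 * (lamH + lamE) * (1 + d * y + 2 * Real.exp (y + 2) * (1 + CE)), by positivity, ?_⟩
  intro pH hH hH2 hdp π hπ g
  have hH1 : pH ≤ 1 := hH2.trans (by norm_num)
  have hpθ : pH ≤ rate pH := le_rate (by linarith)
  have hθ : 0 < rate pH := hH.trans_le hpθ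
  obtain ⟨hb, hβ0, hβ⟩ := chain_compensator hH hH2 hy0
  set β := dev y (rate pH) with hβdef
  set θ := rate pH with hθdef
  set b : ℕ → ℝ := fun n => β n / (Real.exp (θ * n) - 1) with hbdef
  set B := θ * Real.exp (y + 2) with hB
  have hB0 : 0 < B := by positivity
  have hposn : ∀ n : ℕ, 0 < θ * (n + 1 : ℕ) := fun n => by positivity
  have hg0 : ∀ s, 0 ≤ g s := fun s => by
    have hx := hposn s.1
    rcases le_total (θ * (s.1 + 1 : ℕ)) y with h | h
    · refine mul_nonneg_of_nonpos_of_nonpos ((min_le_left _ _).trans (by linarith)) ?_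
      rw [← chainDrift_log hlH hlE]
      exact (chainDrift_strictMonoOn lamE hlH).monotoneOn hx hy0 h
    · refine mul_nonneg (le_min (by linarith) zero_le_one) ?_
      rw [← chainDrift_log hlH hlE]
      exact (chainDrift_strictMonoOn lamE hlH).monotoneOn hy0 hx h
  set F : ℕ → ℝ := psum fun n => (n : ℝ) ^ 2 with hF
  -- An `E` arrival lowers V by about β whether she waits or starts a segment, and an `H` arrival
  -- raises it by at most b(h + 1). The net drift is therefore about -g / (lamH + lamE).
  set V : Market → ℝ := fun s => psum b s.1 - s.2 * β s.1 with hV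
  have hβ1 : ∀ n, β n ≤ 1 := fun n => min_le_right _ _
  have hβy : ∀ n, -y ≤ β n := fun n => le_min (by
    have : 0 ≤ θ * n := by positivity
    linarith) (by linarith)
  have hVdrift : ∀ s, ((isPolicy_chain hH hH1 hE hE1 hd).kernel hlH hlE).op V s ≤
      V s - g s / (2 * (lamH + lamE)) + θ * (1 + d * y) + 2 * B * (1 + (s.2 : ℝ) ^ 2) := by
    intro s
    have h := chain_op_le hH hH1 hE hE1 hd hlH hlE (s := s) (f := V)
      (segment_mean_compensated hH hH1 hE hE1 hB0.le hb hβ0 hβ s)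
    have hq0 := find_nonneg hH.le hH1 d
    have hqd : find pH d ≤ pH * d := find_le_mul hH1 d
    have hQ0 := find_nonneg hE.le hE1 d
    have hQ1 := find_le_one hE1 d
    have hx := exp_sub_one_pos (hposn s.1)
    have hstep1 : V (s.1 + 1, s.2) - V s ≤ b (s.1 + 1) := by
      simp only [hV, psum_succ]
      have : β s.1 ≤ β (s.1 + 1) := min_le_min (by push_cast; linarith) le_rfl
      have e0 : (0 : ℝ) ≤ s.2 := by positivity
      nlinarith
    have hstep2 : V (s.1, s.2 + 1) - V s = -β s.1 := by
      simp only [hV]; push_cast; ring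
    have hβs : β (s.1 + 1) - θ ≤ β s.1 := by
      rw [sub_le_iff_le_add, hβdef, dev, dev, ← min_add_add_right]
      refine min_le_min (by push_cast; linarith) (by linarith)
    have hgs : lamH * b (s.1 + 1) = lamE * β (s.1 + 1) - g s := by
      simp only [hbdef, g, chainDrift]; ring
    have hβy' := hβy (s.1 + 1)
    have hg := hg0 s
    rw [hstep2] at h
    have k1 : lamH * (1 - find pH d) * (V (s.1 + 1, s.2) - V s) ≤
        lamH * (1 - find pH d) * b (s.1 + 1) :=
      mul_le_mul_of_nonneg_left hstep1 (mul_nonneg hlH.le (by nlinarith))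
    -- Arriving `H` agents who are matched at once cost a factor 1 - `find pH d` ≥ 1/2 in front of
    -- g, whence the 2 in the denominator.
    have hq2 : find pH d ≤ 1 / 2 := by linarith
    have hqθ : find pH d ≤ d * θ := by
      have : (0 : ℝ) ≤ d := by positivity
      nlinarith
    have hΛ : lamH * find pH d + lamE * find pE d ≤ lamH + lamE := by nlinarith
    have k2 : (lamH * find pH d + lamE * find pE d) * (B * (1 + (s.2 : ℝ)) ^ 2) ≤
        (lamH + lamE) * (B * (2 * (1 + (s.2 : ℝ) ^ 2))) := by
      refine mul_le_mul hΛ (mul_le_mul_of_nonneg_left ?_ hB0.le) (by positivity) hl.le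
      nlinarith [sq_nonneg (1 - (s.2 : ℝ))]
    have k3 : (lamE + lamH * find pH d) * (β (s.1 + 1) - θ) ≤ (lamE + lamH * find pH d) * β s.1 :=
      mul_le_mul_of_nonneg_left hβs (by positivity)
    have k4 : (lamE + lamH * find pH d) * θ ≤ (lamH + lamE) * θ :=
      mul_le_mul_of_nonneg_right (by nlinarith) hθ.le
    have k5 : find pH d * (lamH + lamE) * (-β (s.1 + 1)) ≤ (d * θ) * (lamH + lamE) * y :=
      (mul_le_mul_of_nonneg_left (by linarith) (by positivity)).trans
        (mul_le_mul_of_nonneg_right (mul_le_mul_of_nonneg_right hqθ hl.le) hy0.le)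
    have k6 : g s / 2 ≤ (1 - find pH d) * g s := by nlinarith
    have k7 : lamH * (1 - find pH d) * b (s.1 + 1) =
        (1 - find pH d) * (lamE * β (s.1 + 1)) - (1 - find pH d) * g s := by
      rw [← mul_sub, ← hgs]; ring
    rw [← mul_le_mul_iff_right₀ hl]
    have k8 : (lamH + lamE) * (V s - g s / (2 * (lamH + lamE)) + θ * (1 + d * y)
        + 2 * B * (1 + (s.2 : ℝ) ^ 2)) = (lamH + lamE) * (V s + θ * (1 + d * y)
        + 2 * B * (1 + (s.2 : ℝ) ^ 2)) - g s / 2 := by field_simp; ring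
    rw [k8]
    linarith
  -- The term 2B F(e) absorbs the error 2B e² by the drift of the `E` agents, uniform in pH. It also
  -- bounds the sum from below, which V alone, containing -e β, is not.
  have hdrift : ∀ s, ((isPolicy_chain hH hH1 hE hE1 hd).kernel hlH hlE).op
      (V + (2 * B) • fun s : Market => F s.2) s ≤ (V + (2 * B) • fun s : Market => F s.2) s
        - g s / (2 * (lamH + lamE)) + (θ * (1 + d * y) + 2 * B * (1 + CE)) := fun s => by
    have h1 := hVdrift s
    have h2 := mul_le_mul_of_nonneg_left (hCE pH hH hH1 s) (by positivity : 0 ≤ 2 * B)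
    rw [map_add, map_smul]
    simp only [Pi.add_apply, Pi.smul_apply, smul_eq_mul]
    linarith
  have hbb : ∀ n, ⌈y / θ⌉₊ ≤ n → 0 ≤ b n := fun n hn => by
    have h1 : y ≤ θ * n := by
      have := Nat.ceil_le.1 hn
      rwa [div_le_iff₀ hθ, mul_comm] at this
    exact div_nonneg (le_min (by linarith) zero_le_one) (exp_sub_one_pos (by linarith)).le
  have hlow : ∀ s, -(∑ j ∈ Finset.range ⌈y / θ⌉₊, |b j|) - 1 / (8 * B) ≤
      (V + (2 * B) • fun s : Market => F s.2) s := fun s => by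
    have h1 := psum_bddBelow hbb s.1
    have h2 : (s.2 : ℝ) * β s.1 ≤ s.2 := mul_le_of_le_one_right (by positivity) (hβ1 _)
    have h3 := mul_le_mul_of_nonneg_left (sq_le_psum_sq s.2) (by positivity : 0 ≤ 2 * B)
    have h4 : (s.2 : ℝ) - 1 / (8 * B) ≤ 2 * B * (s.2 : ℝ) ^ 2 := by
      have : 2 * B * (s.2 : ℝ) ^ 2 - s.2 + 1 / (8 * B) = (4 * B * s.2 - 1) ^ 2 / (8 * B) := by
        field_simp; ring
      have h5 : 0 ≤ (4 * B * s.2 - 1) ^ 2 / (8 * B) := by positivity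
      linarith
    simp only [Pi.add_apply, Pi.smul_apply, smul_eq_mul, hV]
    linarith
  have hfin := hπ.drift_bound (g := fun s => g s / (2 * (lamH + lamE))) hlow
    (fun s => div_nonneg (hg0 s) (by positivity)) (by positivity) hdrift
  have hcomm : (fun s => π s * (g s / (2 * (lamH + lamE))))
      = fun s => (2 * (lamH + lamE))⁻¹ * (π s * g s) := by funext s; ring
  rw [hcomm, tsum_mul_left, summable_mul_left_iff (by positivity), inv_mul_le_iff₀ (by positivity)]
    at hfin
  refine ⟨hg0, hfin.1, hfin.2.trans (le_of_eq ?_)⟩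
  rw [hB]; ring

/-! ### From mean drift bounds to the limits -/

theorem exists_gap {m : ℝ → ℝ} {I : Set ℝ} (hI : Set.Ioi 0 ⊆ I) (hm : StrictMonoOn m I) {y : ℝ}
    (hy : 0 < y) (hmy : m y = 0) {ε : ℝ} (hε : 0 < ε) :
    ∃ c > 0, ∀ x ∈ I, (y + ε ≤ x → c ≤ m x) ∧ (x ≤ y - ε → m x ≤ -c) := by
  set δ := min ε (y / 2) with hδ
  have hδ0 : 0 < δ := lt_min hε (by positivity)
  have hδε : δ ≤ ε := min_le_left _ _
  have hδy : δ ≤ y / 2 := min_le_right _ _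
  have h1 : y + δ ∈ I := hI (by simp only [Set.mem_Ioi]; linarith)
  have h2 : y - δ ∈ I := hI (by simp only [Set.mem_Ioi]; linarith)
  have h3 := hm (hI hy) h1 (by linarith)
  have h4 := hm h2 (hI hy) (by linarith)
  rw [hmy] at h3 h4
  refine ⟨min (m (y + δ)) (-m (y - δ)), lt_min h3 (by linarith), fun x hx => ⟨fun h => ?_, fun h => ?_⟩⟩
  · exact (min_le_left _ _).trans (hm.monotoneOn h1 hx (by linarith))
  · have := hm.monotoneOn hx h2 (by linarith)
    linarith [min_le_right (m (y + δ)) (-m (y - δ))]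

theorem tendsto_of_forall_le {X θ : ℝ → ℝ} {l : ℝ} {F : Filter ℝ} (hθ : Tendsto θ F (𝓝 0))
    (h : ∀ ε > 0, ∃ D : ℝ, ∀ᶠ p in F, |X p - l| ≤ ε + D * θ p) : Tendsto X F (𝓝 l) := by
  rw [Metric.tendsto_nhds]
  intro ε hε
  obtain ⟨D, hD⟩ := h (ε / 2) (by positivity)
  have h1 : Tendsto (fun p => ε / 2 + D * θ p) F (𝓝 (ε / 2 + D * 0)) :=
    tendsto_const_nhds.add (hθ.const_mul D)
  filter_upwards [hD, h1.eventually (gt_mem_nhds (by linarith : ε / 2 + D * 0 < ε))] with p h2 h3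
  rw [Real.dist_eq]
  exact h2.trans_lt h3

theorem FinKernel.IsStat.abs_mean_sub_le {S : Type*} {κ : FinKernel S} {π x u : S → ℝ}
    {y ε c : ℝ} (hπ : κ.IsStat π) (hx : Summable fun s => π s * x s)
    (hxu : ∀ s, |x s - y| ≤ ε + u s) (hu : Summable fun s => π s * u s)
    (hc : ∑' s, π s * u s ≤ c) : |∑' s, π s * x s - y| ≤ ε + c := by
  have h1 := hx.hasSum.sub (hπ.total.mul_right y)
  have h2 := (hπ.total.mul_right ε).add hu.hasSum
  rw [one_mul] at h1 h2
  have h3 : ∀ s, |π s * x s - π s * y| ≤ π s * ε + π s * u s := fun s => by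
    rw [← mul_sub, ← mul_add, abs_mul, abs_of_nonneg (hπ.nonneg s)]
    exact mul_le_mul_of_nonneg_left (hxu s) (hπ.nonneg s)
  rw [abs_le]
  constructor
  · have := hasSum_le (fun s => (abs_le.1 (h3 s)).1) h2.neg h1
    linarith
  · have := hasSum_le (fun s => (abs_le.1 (h3 s)).2) h1 h2
    linarith

/-- The derivative at 0 of p ↦ `rate (a * p)` is a; this converts the rescaled count θh into pH * h.
-/
theorem tendsto_rate_div (a : ℝ) :
    Tendsto (fun p => rate (a * p) / p) (𝓝[>] 0) (𝓝 a) := by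
  have h : HasDerivAt (fun p => rate (a * p)) a 0 := by
    have h1 : HasDerivAt (fun p : ℝ => 1 - a * p) (-(a * 1)) 0 :=
      ((hasDerivAt_id (0 : ℝ)).const_mul a).const_sub 1
    refine ((h1.log (by simp)).neg).congr_deriv ?_
    simp
  refine h.tendsto_slope_zero_right.congr fun p => ?_
  simp [rate, div_eq_inv_mul]

theorem tendsto_rate (a : ℝ) : Tendsto (fun p => rate (a * p)) (𝓝[>] 0) (𝓝 0) := by
  have h1 : Tendsto (fun p : ℝ => p) (𝓝[>] 0) (𝓝 0) := tendsto_nhdsWithin_of_tendsto_nhds tendsto_id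
  have h2 := (tendsto_rate_div a).mul h1
  rw [mul_zero] at h2
  refine h2.congr' ?_
  filter_upwards [self_mem_nhdsWithin] with p hp
  exact div_mul_cancel₀ _ (ne_of_gt hp)

/-- A limit law for the mean number of waiting `H` agents is one for their waiting time. -/
theorem tendsto_mul_avgWaitH {P : ℝ → Kind → Market → Market → ℝ} {lamH lamE a y : ℝ}
    (hlH : 0 < lamH) (hlE : 0 < lamE) (ha : 0 < a)
    (hP : ∀ p, 0 < p → p ≤ 1 → IsPolicy (P p))
    (hex : ∀ p, 0 < p → p ≤ 1 → ∃ π, IsSteadyState (rateMatrix lamH lamE (P p)) π)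
    (hs : ∀ p (h0 : 0 < p) (h1 : p ≤ 1) (π : Market → ℝ),
      ((hP p h0 h1).kernel hlH hlE).IsStat π → Summable fun s : Market => π s * s.1)
    (hlim : ∀ ε > 0, ∃ D : ℝ, ∀ᶠ p in 𝓝[>] (0 : ℝ), ∀ (h0 : 0 < p) (h1 : p ≤ 1) (π : Market → ℝ),
      ((hP p h0 h1).kernel hlH hlE).IsStat π →
      |∑' s : Market, π s * (rate (a * p) * s.1) - y| ≤ ε + D * rate (a * p)) :
    Tendsto (fun p => ENNReal.ofReal p * avgWaitH lamH lamE (P p)) (𝓝[>] 0)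
      (𝓝 (ENNReal.ofReal (y / a / lamH))) := by
  set π : ℝ → Market → ℝ := fun p => steadyState (rateMatrix lamH lamE (P p)) with hπ
  have hstat : ∀ p (h0 : 0 < p) (h1 : p ≤ 1), ((hP p h0 h1).kernel hlH hlE).IsStat (π p) :=
    fun p h0 h1 => ((hP p h0 h1).isSteadyState_iff hlH hlE _).1
      (Classical.epsilon_spec (hex p h0 h1))
  have hunit : ∀ᶠ p in 𝓝[>] (0 : ℝ), 0 < p ∧ p ≤ 1 := by
    filter_upwards [Ioc_mem_nhdsGT (zero_lt_one (α := ℝ))] with p hp using hp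
  have hX : Tendsto (fun p => ∑' s : Market, π p s * (rate (a * p) * s.1)) (𝓝[>] 0) (𝓝 y) := by
    refine tendsto_of_forall_le (tendsto_rate a) fun ε hε => ?_
    obtain ⟨D, hD⟩ := hlim ε hε
    refine ⟨D, ?_⟩
    filter_upwards [hD, hunit] with p h1 h2
    exact h1 h2.1 h2.2 _ (hstat p h2.1 h2.2)
  have hmain := ENNReal.tendsto_ofReal
    ((hX.div (tendsto_rate_div a) ha.ne').div_const lamH)
  refine hmain.congr' ?_
  filter_upwards [hunit, (tendsto_rate_div a).eventually (lt_mem_nhds ha)] with p hp hr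
  have hr' : 0 < rate (a * p) := by
    have := mul_pos hr hp.1
    rwa [div_mul_cancel₀ _ hp.1.ne'] at this
  rw [(hP p hp.1 hp.2).avgWaitH_eq hlH hlE (hstat p hp.1 hp.2) (hs p hp.1 hp.2 _ (hstat p hp.1 hp.2)),
    ← ENNReal.ofReal_mul hp.1.le]
  congr 1
  have : ∀ s : Market, π p s * (rate (a * p) * s.1) = rate (a * p) * (π p s * s.1) := fun s => by
    ring
  rw [Pi.div_apply, tsum_congr this, tsum_mul_left]
  have := hp.1
  field_simp
  rfl

theorem bilateral_limit {lamH lamE pE : ℝ} (hlH : 0 < lamH) (hlt : lamH < lamE) (hE : 0 < pE)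
    (hE1 : pE ≤ 1) :
    Tendsto (fun pH => ENNReal.ofReal pH * avgWaitH lamH lamE (bilateralMatchH pH pE)) (𝓝[>] 0)
      (𝓝 (ENNReal.ofReal (-Real.log (1 - lamH / lamE) / pE / lamH))) := by
  have hlE : 0 < lamE := hlH.trans hlt
  refine tendsto_mul_avgWaitH hlH hlE hE (fun p h0 h1 => isPolicy_bilateral h0 h1 hE hE1)
    (fun p h0 h1 => (bilateral_existsUnique h0 h1 hE hE1 hlH hlE).exists)
    (fun p h0 h1 π hπ => bilateral_summable h0 h1 hE hE1 hlH hlE hπ) fun ε hε => ?_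
  obtain ⟨C, hC0, hC⟩ := bilateral_mean_bound hlH hlt hE hE1
  have hu0 : 0 < 1 - lamH / lamE := sub_pos.2 ((div_lt_one hlE).2 hlt)
  have hu1 : 1 - lamH / lamE < 1 := sub_lt_self _ (by positivity)
  have hy0 : 0 < -Real.log (1 - lamH / lamE) := neg_pos.2 (Real.log_neg hu0 hu1)
  set y := -Real.log (1 - lamH / lamE) with hy
  have hm : StrictMonoOn (fun x => lamE * (1 - Real.exp (-x)) - lamH) Set.univ :=
    fun x _ z _ hxz => by
      have := Real.exp_lt_exp.2 (neg_lt_neg hxz)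
      have := mul_lt_mul_of_pos_left (sub_lt_sub_left this 1) hlE
      simpa using this
  have hmy : lamE * (1 - Real.exp (-y)) - lamH = 0 := by
    rw [hy, neg_neg, Real.exp_log hu0]; field_simp; ring
  obtain ⟨c, hc, hgap⟩ := exists_gap (Set.subset_univ _) hm hy0 hmy hε
  refine ⟨c⁻¹ * C, ?_⟩
  filter_upwards [Ioc_mem_nhdsGT (by norm_num : (0 : ℝ) < 1 / 2)] with p hp h0 h1 π hπ
  obtain ⟨hs, hle⟩ := hC p hp.1 hp.2 π hπ
  set θ := rate (pE * p) with hθ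
  -- Outside the ε-window the drift is at least c in absolute value and has the sign of the
  -- deviation, so c⁻¹ times their product dominates the deviation.
  refine hπ.abs_mean_sub_le
    (u := fun s => c⁻¹ * ((θ * s.1 - y) * (lamE * (1 - Real.exp (-(θ * s.1))) - lamH))) ?_ ?_ ?_ ?_
  · refine ((bilateral_summable h0 h1 hE hE1 hlH hlE hπ).mul_left θ).congr fun s => by ring
  · intro s
    obtain ⟨g1, g2⟩ := hgap (θ * s.1) (Set.mem_univ _)
    have hmono := hm.monotoneOn
    rw [← sub_le_iff_le_add', le_inv_mul_iff₀ hc]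
    have hsign : 0 ≤ (θ * s.1 - y) * (lamE * (1 - Real.exp (-(θ * s.1))) - lamH) := by
      rcases le_total y (θ * s.1) with h | h
      · have := hmono (Set.mem_univ _) (Set.mem_univ _) h
        dsimp only at this
        exact mul_nonneg (by linarith) (by linarith)
      · have := hmono (Set.mem_univ _) (Set.mem_univ _) h
        dsimp only at this
        exact mul_nonneg_of_nonpos_of_nonpos (by linarith) (by linarith)
    rcases le_or_gt (|θ * s.1 - y|) ε with h | h
    · exact (mul_nonpos_of_nonneg_of_nonpos hc.le (by linarith)).trans hsign
    · rcases lt_abs.1 h with h' | h'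
      · have := g1 (by linarith)
        rw [abs_of_pos (by linarith)]
        nlinarith
      · have := g2 (by linarith)
        rw [abs_of_neg (by linarith)]
        nlinarith
  · exact (hs.mul_left c⁻¹).congr fun s => mul_left_comm _ _ _
  · have h2 : ∀ s : Market, π s * (c⁻¹ * ((θ * s.1 - y)
        * (lamE * (1 - Real.exp (-(θ * s.1))) - lamH))) = c⁻¹ * (π s * ((θ * s.1 - y)
        * (lamE * (1 - Real.exp (-(θ * s.1))) - lamH))) := fun s => mul_left_comm _ _ _
    rw [tsum_congr h2, tsum_mul_left, mul_assoc]
    exact mul_le_mul_of_nonneg_left hle (inv_nonneg.2 hc.le)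

theorem chain_limit {lamH lamE pE : ℝ} (hlH : 0 < lamH) (hlE : 0 < lamE) (hE : 0 < pE)
    (hE1 : pE ≤ 1) {d : ℕ} (hd : 1 ≤ d) :
    Tendsto (fun pH => ENNReal.ofReal pH * avgWaitH lamH lamE (chainMatch d pH pE)) (𝓝[>] 0)
      (𝓝 (ENNReal.ofReal (Real.log (1 + lamH / lamE) / 1 / lamH))) := by
  refine tendsto_mul_avgWaitH hlH hlE one_pos (fun p h0 h1 => isPolicy_chain h0 h1 hE hE1 hd)
    (fun p h0 h1 => (chain_existsUnique hlH hlE h0 h1 hE hE1 hd).exists)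
    (fun p h0 h1 π hπ => chain_summable h0 h1 hE hE1 hd hlH hlE hπ) fun ε hε => ?_
  obtain ⟨C, hC0, hC⟩ := chain_mean_bound hE hE1 hd hlH hlE
  obtain ⟨K, C', hK0, hC'0, hC'⟩ := chain_tail_bound hE hE1 hd hlH hlE
  have hy0 : 0 < Real.log (1 + lamH / lamE) :=
    Real.log_pos (by have : 0 < lamH / lamE := by positivity
                     linarith)
  obtain ⟨c, hc, hgap⟩ := exists_gap subset_rfl (chainDrift_strictMonoOn lamE hlH) hy0
    (chainDrift_log hlH hlE) hε
  set y := Real.log (1 + lamH / lamE) with hy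
  -- Outside the ε-window g ≥ c * min ε 1, so D g ≥ K + 1 + y. Since the deviation in g is truncated
  -- at 1, this covers |x - y| only up to level K; the tail term does the rest.
  set D := (K + 1 + y) / (c * min ε 1) with hD
  have hmin : 0 < min ε 1 := lt_min hε one_pos
  have hD0 : 0 ≤ D := by positivity
  have hDc : D * (c * min ε 1) = K + 1 + y := by rw [hD]; field_simp
  refine ⟨D * C + C' + 1, ?_⟩
  have hdp : Tendsto (fun p : ℝ => d * p) (𝓝[>] 0) (𝓝 (d * 0)) :=
    (tendsto_nhdsWithin_of_tendsto_nhds tendsto_id).const_mul _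
  rw [mul_zero] at hdp
  filter_upwards [Ioc_mem_nhdsGT (by norm_num : (0 : ℝ) < 1 / 2),
    hdp.eventually (ge_mem_nhds (by norm_num : (0 : ℝ) < 1 / 2))] with p hp hdp h0 h1 π hπ
  obtain ⟨hg0, hs, hle⟩ := hC p hp.1 hp.2 hdp π hπ
  obtain ⟨hs', hle'⟩ := hC' p hp.1 (hp.2.trans_lt (by norm_num)) π hπ
  have hθ1 := rate_le_one hp.2
  have hθ0 : 0 < rate p := hp.1.trans_le (le_rate (hp.2.trans_lt (by norm_num)))
  rw [one_mul]
  set θ := rate p with hθ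
  set g : Market → ℝ := fun s => dev y θ (s.1 + 1) * chainDrift lamH lamE (θ * (s.1 + 1 : ℕ))
    with hg
  have hsum := (chain_summable h0 h1 hE hE1 hd hlH hlE hπ).mul_left θ
  -- The drift involves h + 1, the count after an `H` arrival, which also keeps exp(x) - 1 positive.
  -- The shift changes the mean by θ only.
  have key := hπ.abs_mean_sub_le (x := fun s => θ * (s.1 + 1 : ℕ)) (y := y) (ε := ε)
    (u := fun s => D * g s + max 0 (θ * s.1 - K)) (c := D * (C * θ) + C' * θ)
    ((hsum.add (hπ.total.summable.mul_right θ)).congr fun s => by push_cast; ring)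
    (fun s => by
      have hx : 0 < θ * (s.1 + 1 : ℕ) := by positivity
      obtain ⟨g1, g2⟩ := hgap _ hx
      have ht := le_max_left 0 (θ * s.1 - K)
      have ht' := le_max_right 0 (θ * s.1 - K)
      have hDg := mul_nonneg hD0 (hg0 s)
      rcases le_or_gt (|θ * (s.1 + 1 : ℕ) - y|) ε with h | h
      · linarith
      · have hbig : K + 1 + y ≤ D * g s := by
          rw [← hDc]
          refine mul_le_mul_of_nonneg_left ?_ hD0
          simp only [hg, dev]
          rcases lt_abs.1 h with h' | h'
          · have h2 := g1 (by linarith)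
            have h3 : min ε 1 ≤ min (θ * (s.1 + 1 : ℕ) - y) 1 := min_le_min h'.le le_rfl
            rw [mul_comm c]
            exact mul_le_mul h3 h2 hc.le (hmin.le.trans h3)
          · have h2 := g2 (by linarith)
            rw [min_eq_left (a := θ * (s.1 + 1 : ℕ) - y) (by linarith)]
            have h3 : min ε 1 ≤ -(θ * (s.1 + 1 : ℕ) - y) := (min_le_left _ _).trans h'.le
            rw [mul_comm c, ← neg_mul_neg (θ * (s.1 + 1 : ℕ) - y)]
            exact mul_le_mul h3 (by linarith) hc.le (hmin.le.trans h3)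
        have : |θ * (s.1 + 1 : ℕ) - y| ≤ max 0 (θ * s.1 - K) + (K + 1 + y) := by
          rw [abs_le]
          constructor
          · linarith
          · push_cast; linarith
        linarith)
    (((hs.mul_left D).add hs').congr fun s => by simp only [hg]; ring)
    (by
      have h2 := (hs.hasSum.mul_left D).add hs'.hasSum
      have h3 : ∀ s : Market, π s * (D * g s + max 0 (θ * s.1 - K))
          = D * (π s * g s) + π s * max 0 (θ * s.1 - K) := fun s => by ring
      rw [tsum_congr h3, h2.tsum_eq]
      exact add_le_add (mul_le_mul_of_nonneg_left hle hD0) hle')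
  have hshift : ∑' s : Market, π s * (θ * (s.1 + 1 : ℕ)) = ∑' s : Market, π s * (θ * s.1) + θ := by
    have h2 : Summable fun s : Market => π s * (θ * s.1) := hsum.congr fun s => by ring
    have h3 := h2.hasSum.add (hπ.total.mul_right θ)
    rw [one_mul] at h3
    rw [← h3.tsum_eq]
    exact tsum_congr fun s => by push_cast; ring
  rw [hshift] at key
  rw [abs_le] at key ⊢
  have hnn : 0 ≤ D * C + C' := by positivity
  constructor <;> linarith [key.1, key.2]

/-! ### Comparison of the two limits -/

theorem log_one_add_lt {u : ℝ} (h0 : 0 < u) (h1 : u < 1) :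
    Real.log (1 + u) < -Real.log (1 - u) := by
  rw [← Real.log_inv]
  refine Real.log_lt_log (by linarith) ?_
  rw [lt_inv_comm₀ (by linarith) (by linarith), inv_eq_one_div, lt_div_iff₀ (by linarith)]
  nlinarith

end DynMatch

theorem mainTheorem6 (lamH lamE pE : ℝ) (d : ℕ) (hH : 0 < lamH) (hHE : lamH < lamE)
    (hpE : 0 < pE) (hpE1 : pE ≤ 1) (hd : 1 ≤ d) :
    (∀ pH : ℝ, 0 < pH → pH ≤ 1 →
      (∃! π, DynMatch.IsSteadyState
        (DynMatch.rateMatrix lamH lamE (DynMatch.chainMatch d pH pE)) π) ∧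
      (∃! π, DynMatch.IsSteadyState
        (DynMatch.rateMatrix lamH lamE (DynMatch.bilateralMatchH pH pE)) π)) ∧
    ∃ wC wB : ℝ, 0 < wC ∧ wC < wB ∧
      Filter.Tendsto
        (fun pH : ℝ => ENNReal.ofReal pH *
          DynMatch.avgWaitH lamH lamE (DynMatch.chainMatch d pH pE))
        (nhdsWithin 0 (Set.Ioi 0)) (nhds (ENNReal.ofReal wC)) ∧
      Filter.Tendsto
        (fun pH : ℝ => ENNReal.ofReal pH *
          DynMatch.avgWaitH lamH lamE (DynMatch.bilateralMatchH pH pE))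
        (nhdsWithin 0 (Set.Ioi 0)) (nhds (ENNReal.ofReal wB)) := by
  have hE : 0 < lamE := hH.trans hHE
  have hu0 : 0 < lamH / lamE := by positivity
  have hu1 : lamH / lamE < 1 := (div_lt_one hE).2 hHE
  have hlog := DynMatch.log_one_add_lt hu0 hu1
  have hpos : 0 < Real.log (1 + lamH / lamE) := Real.log_pos (by linarith)
  refine ⟨fun pH h0 h1 => ⟨DynMatch.chain_existsUnique hH hE h0 h1 hpE hpE1 hd,
    DynMatch.bilateral_existsUnique h0 h1 hpE hpE1 hH hE⟩, _, _, ?_, ?_,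
    DynMatch.chain_limit hH hE hpE hpE1 hd, DynMatch.bilateral_limit hH hHE hpE hpE1⟩
  · positivity
  · refine div_lt_div_of_pos_right ?_ hH
    rw [div_one]
    refine hlog.trans_le (le_div_self (hpos.trans hlog).le hpE hpE1)
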